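/- All graphs are finite, undirected, and may have parallel edges. A graph is $k$-edge-connected if it remains connected after the deletion of any set of fewer than $k$ edges. For a graph $G$, let $M_G$ be its cycle matroid (ground set $E(G)$; independent sets are the edge sets containing no cycle). The basis graph $\operatorname{BG}(M)$ of a matroid $M$ has the bases of $M$ as vertices, two bases $B_1,B_2$ being adjacent if and only if $|B_1\,\Delta\, B_2|=2$. For an edge $e$ of $\operatorname{BG}(M)$ let $\operatorname{HC}_e(M)$ be the number of different Hamiltonian cycles of $\operatorname{BG}(M)$ that contain $e$, let $\operatorname{HC}^*(M)=\min\{\operatorname{HC}_e(M): e\in E(\operatorname{BG}(M))\}$, and let $\operatorname{hc}(n,k)=\min\{\operatorname{HC}^*(M_G): G \text{ is a } k\text{-edge-connected graph of order } n\}$. **Theorem.** For every integer $n\ge 3$ and every $3$-edge-connected graph $G$ of order $n$, every edge of $\operatorname{BG}(M_G)$ lies in at least $(n-2)!\,2^{\binom{n-1}{2}}$ different Hamiltonian cycles of $\operatorname{BG}(M_G)$. In other words, $$\operatorname{hc}(n,3)\ \ge\ (n-2)!\,2^{\binom{n-1}{2}}.$$ -/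

import Mathlib

open scoped Graph symmDiff

namespace SimpleGraph

open Classical in
/-- The edge sets of the Hamiltonian cycles of `H`. (A Hamiltonian cycle, as a subgraph, is
determined by its edge set; different starting points and the two directions of travel give the
same cycle.) -/
def hamiltonianCycles {W : Type*} (H : SimpleGraph W) : Set (Set (Sym2 W)) :=
  {C | ∃ (w : W) (p : H.Walk w w), p.IsHamiltonianCycle ∧ C = {e | e ∈ p.edges}}

/-- The number of different Hamiltonian cycles of `H` that contain the edge `e`. -/
noncomputable def numHamiltonianCycles {W : Type*} (H : SimpleGraph W) (e : Sym2 W) : ℕ :=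
  {C ∈ H.hamiltonianCycles | e ∈ C}.ncard

end SimpleGraph

namespace Matroid

/-- The basis graph of a matroid: its vertices are the bases, and two bases are adjacent when
their symmetric difference has exactly two elements. -/
def basisGraph {β : Type*} (M : Matroid β) : SimpleGraph {B : Set β // M.IsBase B} where
  Adj B₁ B₂ := ((B₁ : Set β) ∆ (B₂ : Set β)).encard = 2
  symm := ⟨fun _ _ h => by rwa [symmDiff_comm]⟩
  loopless := ⟨fun _ h => by simp at h⟩

/-- The minimum, over the edges of the basis graph, of the number of Hamiltonian cycles of the
basis graph through that edge. -/
noncomputable def minHamiltonianCycles {β : Type*} (M : Matroid β) : ℕ :=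
  sInf {m | ∃ e ∈ M.basisGraph.edgeSet, m = M.basisGraph.numHamiltonianCycles e}

end Matroid

namespace Graph

/-- A multigraph is connected if it has a vertex and any two of its vertices are joined by a
walk. -/
def Connected {α β : Type*} (G : Graph α β) : Prop :=
  V(G).Nonempty ∧ ∀ x ∈ V(G), ∀ y ∈ V(G), Relation.ReflTransGen G.Adj x y

/-- `G` is `k`-edge-connected if it stays connected after the deletion of any set of fewer than
`k` edges. -/
def IsEdgeConnected {α β : Type*} (G : Graph α β) (k : ℕ) : Prop :=
  ∀ F ⊆ E(G), F.encard < k → (G.deleteEdges F).Connected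

/-- `C` is the edge set of a cycle of `G`: there are distinct vertices `v 0, …, v k` and distinct
edges `e 0, …, e k` such that `e i` joins `v i` to `v (i + 1)`, indices being taken modulo `k + 1`.
(Loops are the cycles of length one, pairs of parallel edges are the cycles of length two.) -/
def IsCycleSet {α β : Type*} (G : Graph α β) (C : Set β) : Prop :=
  ∃ (k : ℕ) (v : Fin (k + 1) → α) (e : Fin (k + 1) → β),
    Function.Injective v ∧ Function.Injective e ∧
      (∀ i, G.IsLink (e i) (v i) (v (i + 1))) ∧ Set.range e = C

/-- A set of edges is a forest if it contains the edge set of no cycle. -/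
def IsForest {α β : Type*} (G : Graph α β) (F : Set β) : Prop :=
  F ⊆ E(G) ∧ ∀ C ⊆ F, ¬ G.IsCycleSet C

open Classical in
/-- The incidence vector modulo 2 of an edge (an auxiliary notion, used only to verify the
matroid axioms below). -/
noncomputable def incVec {α β : Type*} (G : Graph α β) (e : β) : α →₀ ZMod 2 :=
  if h : ∃ p : α × α, G.IsLink e p.1 p.2 then
    Finsupp.single h.choose.1 1 + Finsupp.single h.choose.2 1 else 0

theorem incVec_eq {α β : Type*} (G : Graph α β) {e : β} {x y : α} (h : G.IsLink e x y) :
    G.incVec e = Finsupp.single x 1 + Finsupp.single y 1 := by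
  have hex : ∃ p : α × α, G.IsLink e p.1 p.2 := ⟨(x, y), h⟩
  rw [incVec, dif_pos hex]
  have hs := hex.choose_spec
  rcases (h.isLink_iff.1 hs) with ⟨h1, h2⟩ | ⟨h1, h2⟩
  · rw [← h1, ← h2]
  · rw [h1, h2, add_comm]

/-- The simple graph underlying the edge set `F`. -/
def linkGraph {α β : Type*} (G : Graph α β) (F : Set β) : SimpleGraph α :=
  SimpleGraph.fromRel fun a b => ∃ f ∈ F, G.IsLink f a b

theorem linkGraph_adj {α β : Type*} {G : Graph α β} {F : Set β} {a b : α} :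
    (G.linkGraph F).Adj a b ↔ a ≠ b ∧ ∃ f ∈ F, G.IsLink f a b := by
  simp only [linkGraph, SimpleGraph.fromRel_adj]
  constructor
  · rintro ⟨h, ⟨f, hf, hl⟩ | ⟨f, hf, hl⟩⟩
    · exact ⟨h, f, hf, hl⟩
    · exact ⟨h, f, hf, hl.symm⟩
  · rintro ⟨h, h'⟩
    exact ⟨h, Or.inl h'⟩

theorem IsForest.not_reachable {α β : Type*} {G : Graph α β} {F : Set β} (hF : G.IsForest F)
    {e : β} (he : e ∈ F) {x y : α} (h : G.IsLink e x y) :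
    ¬ (G.linkGraph (F \ {e})).Reachable x y := by
  classical
  rintro ⟨w⟩
  obtain ⟨p, hp⟩ : ∃ p : (G.linkGraph (F \ {e})).Walk x y, p.IsPath :=
    ⟨w.toPath, w.toPath.2⟩
  have hedge : ∀ i : ℕ, i < p.length →
      ∃ f ∈ F \ {e}, G.IsLink f (p.getVert i) (p.getVert (i + 1)) := fun i hi =>
    (linkGraph_adj.1 (p.adj_getVert_succ hi)).2
  have hne : Nonempty β := ⟨e⟩
  choose! g hgF hg using hedge
  have hinj : ∀ i j : ℕ, i ≤ p.length → j ≤ p.length → p.getVert i = p.getVert j → i = j :=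
    fun i j hi hj hij => hp.getVert_injOn hi hj hij
  let c : Fin (p.length + 1) → β := fun i => if (i : ℕ) < p.length then g i else e
  refine hF.2 (Set.range c) ?_ ⟨p.length, fun i => p.getVert i, c, ?_, ?_, ?_, rfl⟩
  · rintro _ ⟨i, rfl⟩
    by_cases hi : (i : ℕ) < p.length
    · simpa [c, hi] using (hgF i hi).1
    · simpa [c, hi] using he
  · intro i j hij
    exact Fin.ext (hinj i j (by omega) (by omega) hij)
  · intro i j hij
    by_cases hi : (i : ℕ) < p.length <;> by_cases hj : (j : ℕ) < p.length
    · simp only [c, hi, hj, if_true] at hij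
      have h1 := hg i hi
      have h2 := hg j hj
      rw [hij] at h1
      rcases h1.isLink_iff.1 h2 with ⟨h3, -⟩ | ⟨h3, h4⟩
      · exact Fin.ext (hinj _ _ hi.le hj.le h3)
      · have h5 := hinj _ _ (by omega) (by omega) h3
        have h6 := hinj _ _ (by omega) (by omega) h4
        omega
    · simp only [c, hi, hj, if_true, if_false] at hij
      exact absurd hij (hgF i hi).2
    · simp only [c, hi, hj, if_true, if_false] at hij
      exact absurd hij.symm (hgF j hj).2
    · exact Fin.ext (by omega)
  · intro i
    by_cases hi : (i : ℕ) < p.length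
    · have h1 : ((i + 1 : Fin (p.length + 1)) : ℕ) = i + 1 := by
        rw [Fin.val_add_one, if_neg]
        rintro rfl
        simp at hi
      simpa [c, hi, h1] using hg i hi
    · have h0 : i = Fin.last _ := Fin.ext (by simp; omega)
      subst h0
      simpa [c] using h.symm

theorem isForest_iff {α β : Type*} (G : Graph α β) (F : Set β) :
    G.IsForest F ↔ F ⊆ E(G) ∧ LinearIndepOn (ZMod 2) G.incVec F := by
  classical
  constructor
  · intro hF
    refine ⟨hF.1, linearIndepOn_iff_notMem_span.2 fun e he hspan => ?_⟩
    obtain ⟨x, y, hxy⟩ := G.exists_isLink_of_mem_edgeSet (hF.1 he)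
    have hnr := hF.not_reachable he hxy
    let K : α → ZMod 2 := fun z => if (G.linkGraph (F \ {e})).Reachable x z then 1 else 0
    let φ := Finsupp.linearCombination (ZMod 2) K
    have hφ : ∀ a b, φ (Finsupp.single a 1 + Finsupp.single b 1) = K a + K b := by
      intro a b
      simp [φ, Finsupp.linearCombination_single]
    have hle : Submodule.span (ZMod 2) (G.incVec '' (F \ {e})) ≤ LinearMap.ker φ := by
      rw [Submodule.span_le]
      rintro _ ⟨f, hf, rfl⟩
      obtain ⟨a, b, hab⟩ := G.exists_isLink_of_mem_edgeSet (hF.1 hf.1)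
      have hK : K a = K b := by
        by_cases hne : a = b
        · rw [hne]
        · have hr : (G.linkGraph (F \ {e})).Reachable a b :=
            (linkGraph_adj.2 ⟨hne, f, hf, hab⟩).reachable
          have : (G.linkGraph (F \ {e})).Reachable x a ↔
              (G.linkGraph (F \ {e})).Reachable x b :=
            ⟨fun h => h.trans hr, fun h => h.trans hr.symm⟩
          simp only [K, this]
      rw [SetLike.mem_coe, LinearMap.mem_ker, G.incVec_eq hab, hφ, hK]
      exact CharTwo.add_self_eq_zero _
    have h0 := hle hspan
    rw [LinearMap.mem_ker, G.incVec_eq hxy, hφ] at h0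
    simp [K, hnr] at h0
  · rintro ⟨hE, hli⟩
    refine ⟨hE, ?_⟩
    rintro C hC ⟨k, v, e, -, he, hl, rfl⟩
    have hli' : LinearIndependent (ZMod 2) fun i => G.incVec (e i) := by
      have h1 : LinearIndependent (ZMod 2) fun f : F => G.incVec f := hli
      exact h1.comp (fun i => (⟨e i, hC ⟨i, rfl⟩⟩ : F))
        (fun i j hij => he (congrArg Subtype.val hij))
    have hsum : ∑ i, (1 : ZMod 2) • G.incVec (e i) = 0 := by
      have h1 : ∀ i, (1 : ZMod 2) • G.incVec (e i) =
          Finsupp.single (v i) 1 + Finsupp.single (v (i + 1)) 1 := fun i => by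
        rw [one_smul, G.incVec_eq (hl i)]
      simp_rw [h1]
      rw [Finset.sum_add_distrib,
        Fintype.sum_equiv (Equiv.addRight (1 : Fin (k + 1)))
          (fun i => Finsupp.single (v (i + 1)) (1 : ZMod 2))
          (fun i => Finsupp.single (v i) (1 : ZMod 2)) (fun _ => rfl)]
      ext z
      exact CharTwo.add_self_eq_zero _
    have := Fintype.linearIndependent_iff.1 hli' (fun _ => 1) hsum 0
    exact one_ne_zero this

/-- The cycle matroid of a multigraph: the ground set is the set of edges, and the independent
sets are the forests. -/
noncomputable def cycleMatroid {α β : Type*} (G : Graph α β) : Matroid β :=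
  (IndepMatroid.ofFinitaryCardAugment E(G) G.IsForest
    (indep_empty := by
      rw [isForest_iff]
      exact ⟨Set.empty_subset _, linearIndepOn_empty _ _⟩)
    (indep_subset := fun I J hJ hIJ =>
      ⟨hIJ.trans hJ.1, fun C hC => hJ.2 C (hC.trans hIJ)⟩)
    (indep_aug := by
      intro I J hI hIf hJ hJf hlt
      by_contra! hcon
      rw [isForest_iff] at hI hJ
      have hsub : G.incVec '' J ⊆ Submodule.span (ZMod 2) (G.incVec '' I) := by
        rintro _ ⟨e, he, rfl⟩
        by_cases heI : e ∈ I
        · exact Submodule.subset_span ⟨e, heI, rfl⟩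
        · by_contra hns
          refine hcon e he heI ((isForest_iff _ _).2
            ⟨Set.insert_subset (hJ.1 he) hI.1, ?_⟩)
          exact hI.2.insert hns
      have hle : Submodule.span (ZMod 2) (G.incVec '' J) ≤
          Submodule.span (ZMod 2) (G.incVec '' I) := Submodule.span_le.2 hsub
      let _ := hIf.fintype
      let _ := hJf.fintype
      have : Module.Finite (ZMod 2) (Submodule.span (ZMod 2) (G.incVec '' I)) :=
        FiniteDimensional.span_of_finite _ (hIf.image _)
      have h1 := Submodule.finrank_mono hle
      have e1 := finrank_span_eq_card (R := ZMod 2) hI.2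
      have e2 := finrank_span_eq_card (R := ZMod 2) hJ.2
      rw [← Set.image_eq_range] at e1 e2
      rw [e1, e2, ← Nat.card_eq_fintype_card, ← Nat.card_eq_fintype_card,
        Nat.card_coe_set_eq, Nat.card_coe_set_eq] at h1
      omega)
    (indep_compact := by
      intro I hI
      refine ⟨fun e he => (hI {e} (by simpa) (Set.finite_singleton e)).1 rfl, ?_⟩
      rintro C hC ⟨k, v, e, hv, he, hl, rfl⟩
      exact (hI _ hC (Set.finite_range e)).2 _ subset_rfl ⟨k, v, e, hv, he, hl, rfl⟩)
    (subset_ground := fun I hI => hI.1)).matroid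

/-- The minimum of the numbers `minHamiltonianCycles` of the cycle matroids of the
`k`-edge-connected (finite) graphs of order `n`. -/
noncomputable def hc (n k : ℕ) : ℕ :=
  sInf {m | ∃ (α β : Type) (G : Graph α β), V(G).encard = n ∧ E(G).Finite ∧
    G.IsEdgeConnected k ∧ m = G.cycleMatroid.minHamiltonianCycles}

end Graph

/-! Let `A` and `B` be adjacent bases with a common element `g`. The bases containing `g` are those
of the contraction by `g`, and the bases avoiding `g` are those of the deletion. In a Hamiltonian
path of the contraction from `A` to `B`, any one edge `U V` can be replaced by a detour: step from
`U` to some `X` avoiding `g`, run through the whole deletion from `X` to some `Y`, and step from `Y`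
to `V`. The path, the chosen edge and the detour can be read off from the result, so the counts
multiply (`mul_le_ncard_hamPaths`).

A detour exists as soon as `X` and `Y` can be chosen adjacent (`IsExit`), because by the
Harary–Holzmann theorem (`nonempty_hamPaths`) adjacent bases are joined by a Hamiltonian path.

In a 3-edge-connected graph any two edges can be avoided by a spanning tree, and two distinct 3-edge
bonds share at most one edge, since otherwise their symmetric difference would contain a cut of at
most two edges. This property (`IsThick`) survives contraction and gives every edge `U V` two exits
with different `X`. Deletion weakens it to `IsThin`, which also survives contraction and still gives
one exit.

A family of rank `r` without coloops has more than `r` members, so a Hamiltonian path of the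
contraction has at least `r - 1` edges. Induction gives `(r - 1)!` paths in the thin case. In the
thick case each edge has at least `2 * (r - 1)! ≥ 2 ^ (r - 1)` detours, whence `(r - 1)! * 2 ^
(r.choose 2)` paths. For a connected graph of order `n` the rank is at least `n - 1`, and closing a
path by the edge `A B` gives a Hamiltonian cycle. -/

namespace SetFamily

/-! ### Basis families, Hamiltonian paths and detours. -/

/-- `V` arises from `U` by exchanging one element. -/
def Exch {β : Type*} (U V : Set β) : Prop := ∃ a ∈ U, ∃ b ∉ U, V = insert b (U \ {a})

theorem Exch.symm {β : Type*} {U V : Set β} (h : Exch U V) : Exch V U := by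
  obtain ⟨a, ha, b, hb, rfl⟩ := h
  refine ⟨b, Set.mem_insert _ _, a, ?_, ?_⟩
  · rintro (rfl | h)
    · exact hb ha
    · exact h.2 rfl
  · ext z
    simp only [Set.mem_insert_iff, Set.mem_sdiff, Set.mem_singleton_iff]
    grind

/-- A family of sets with the symmetric basis exchange properties. -/
structure IsBasisFamily {β : Type*} (F : Set (Set β)) : Prop where
  exchange : ∀ U ∈ F, ∀ V ∈ F, ∀ a ∈ U \ V, ∃ b ∈ V \ U, insert b (U \ {a}) ∈ F
  rev_exchange : ∀ U ∈ F, ∀ V ∈ F, ∀ b ∈ V \ U, ∃ a ∈ U \ V, insert b (U \ {a}) ∈ F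

theorem IsBasisFamily.sep_mem {β : Type*} {F : Set (Set β)} (h : IsBasisFamily F) (g : β) :
    IsBasisFamily {B ∈ F | g ∈ B} where
  exchange := by
    rintro U ⟨hU, hgU⟩ V ⟨hV, hgV⟩ a ha
    obtain ⟨b, hb, hF⟩ := h.exchange U hU V hV a ha
    exact ⟨b, hb, hF, Or.inr ⟨hgU, fun h => ha.2 (h ▸ hgV)⟩⟩
  rev_exchange := by
    rintro U ⟨hU, hgU⟩ V ⟨hV, hgV⟩ b hb
    obtain ⟨a, ha, hF⟩ := h.rev_exchange U hU V hV b hb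
    exact ⟨a, ha, hF, Or.inr ⟨hgU, fun h => ha.2 (h ▸ hgV)⟩⟩

theorem IsBasisFamily.sep_notMem {β : Type*} {F : Set (Set β)} (h : IsBasisFamily F) (g : β) :
    IsBasisFamily {B ∈ F | g ∉ B} where
  exchange := by
    rintro U ⟨hU, hgU⟩ V ⟨hV, hgV⟩ a ha
    obtain ⟨b, hb, hF⟩ := h.exchange U hU V hV a ha
    exact ⟨b, hb, hF, by rintro (rfl | h'); exacts [hgV hb.1, hgU h'.1]⟩
  rev_exchange := by
    rintro U ⟨hU, hgU⟩ V ⟨hV, hgV⟩ b hb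
    obtain ⟨a, ha, hF⟩ := h.rev_exchange U hU V hV b hb
    exact ⟨a, ha, hF, by rintro (rfl | h'); exacts [hgV hb.1, hgU h'.1]⟩

/-- `l` lists the members of `F`, each exactly once, from `A` to `B`, so that consecutive members
differ by an exchange. -/
structure IsHamPath {β : Type*} (F : Set (Set β)) (A B : Set β) (l : List (Set β)) : Prop where
  nodup : l.Nodup
  mem_iff : ∀ X, X ∈ l ↔ X ∈ F
  chain : l.IsChain Exch
  head : l.head? = some A
  last : l.getLast? = some B

/-- The Hamiltonian paths of `F` from `A` to `B`. -/
def hamPaths {β : Type*} (F : Set (Set β)) (A B : Set β) : Set (List (Set β)) :=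
  {l | IsHamPath F A B l}

theorem finite_hamPaths {β : Type*} (F : Set (Set β)) (A B : Set β) : (hamPaths F A B).Finite := by
  classical
  rcases (hamPaths F A B).eq_empty_or_nonempty with h | ⟨l₀, h₀⟩
  · rw [h]; exact Set.finite_empty
  · refine (List.finite_toSet l₀.permutations).subset fun l hl => ?_
    rw [Set.mem_ofPred_eq, List.mem_permutations, List.perm_ext_iff_of_nodup hl.nodup h₀.nodup]
    exact fun X => (hl.mem_iff X).trans (h₀.mem_iff X).symm

theorem IsHamPath.length_eq {β : Type*} {F : Set (Set β)} {A B : Set β} {l : List (Set β)}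
    (h : IsHamPath F A B l) : l.length = F.ncard := by
  classical
  rw [← List.toFinset_card_of_nodup h.nodup, ← Set.ncard_coe_finset]
  congr 1
  ext X
  simp [h.mem_iff]

theorem IsHamPath.left_mem {β : Type*} {F : Set (Set β)} {A B : Set β} {l : List (Set β)}
    (h : IsHamPath F A B l) : A ∈ F :=
  (h.mem_iff A).1 (List.mem_of_mem_head? h.head)

theorem IsHamPath.right_mem {β : Type*} {F : Set (Set β)} {A B : Set β} {l : List (Set β)}
    (h : IsHamPath F A B l) : B ∈ F :=
  (h.mem_iff B).1 (List.mem_of_getLast? h.last)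

/-- The Hamiltonian paths of the members avoiding `g` that can replace the edge `U V`. -/
def detours {β : Type*} (F : Set (Set β)) (g : β) (U V : Set β) : Set (List (Set β)) :=
  {q | ∃ X Y, Exch U X ∧ Exch Y V ∧ IsHamPath {B ∈ F | g ∉ B} X Y q}

theorem IsHamPath.insert_detour {β : Type*} {F : Set (Set β)} {g : β} {A B U V : Set β}
    {l₁ l₂ q : List (Set β)} (h : IsHamPath {B ∈ F | g ∈ B} A B (l₁ ++ l₂))
    (hU : l₁.getLast? = some U) (hV : l₂.head? = some V) (hq : q ∈ detours F g U V) :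
    IsHamPath F A B (l₁ ++ (q ++ l₂)) := by
  obtain ⟨X, Y, hX, hY, hq⟩ := hq
  have hl₁ : l₁ ≠ [] := by rintro rfl; simp at hU
  have hl₂ : l₂ ≠ [] := by rintro rfl; simp at hV
  have hd : ∀ Z ∈ q, Z ∉ l₁ ++ l₂ := fun Z hZ hZ' =>
    ((hq.mem_iff Z).1 hZ).2 ((h.mem_iff Z).1 hZ').2
  refine ⟨?_, fun Z => ?_, ?_, ?_, ?_⟩
  · have h1 : (q ++ (l₁ ++ l₂)).Nodup :=
      List.nodup_append'.2 ⟨hq.nodup, h.nodup, fun Z hZ hZ' => hd Z hZ hZ'⟩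
    refine (List.Perm.nodup_iff ?_).1 h1
    rw [← List.append_assoc, ← List.append_assoc]
    exact List.perm_append_comm.append_right _
  · have h1 := hq.mem_iff Z
    have h2 := h.mem_iff Z
    simp only [List.mem_append, Set.mem_ofPred_eq] at *
    tauto
  · have hc := List.isChain_append.1 h.chain
    rw [List.isChain_append, List.isChain_append]
    refine ⟨hc.1, ⟨hq.chain, hc.2.1, ?_⟩, ?_⟩
    · rw [hq.last, hV]; simpa using hY
    · rw [hU, List.head?_append, hq.head]; simpa using hX
  · have := h.head
    rw [List.head?_append_of_ne_nil _ hl₁] at this ⊢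
    exact this
  · have := h.last
    rw [List.getLast?_append_of_ne_nil _ hl₂] at this
    rw [List.getLast?_append_of_ne_nil _ (by simp [hl₂]), List.getLast?_append_of_ne_nil _ hl₂]
    exact this

theorem IsHamPath.exch_split {β : Type*} {F : Set (Set β)} {A B : Set β} {l : List (Set β)}
    (h : IsHamPath F A B l) {i : ℕ} (hi : i + 1 < l.length) :
    Exch l[i] l[i + 1] ∧ (l.take (i + 1)).getLast? = some l[i] ∧
      (l.drop (i + 1)).head? = some l[i + 1] := by
  have hU : (l.take (i + 1)).getLast? = some (l[i]'(by omega)) := by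
    rw [List.getLast?_take]; simp [List.getElem?_eq_getElem (show i < l.length by omega)]
  have hV : (l.drop (i + 1)).head? = some l[i + 1] := by
    rw [List.head?_drop, List.getElem?_eq_getElem hi]
  refine ⟨?_, hU, hV⟩
  have := h.chain
  rw [← List.take_append_drop (i + 1) l, List.isChain_append] at this
  exact this.2.2 _ hU _ hV

/-- Inserting detours gives many Hamiltonian paths. -/
theorem mul_le_ncard_hamPaths {β : Type*} {F : Set (Set β)} {g : β} {A B : Set β} {k : ℕ}
    (hk : ∀ U V, U ∈ F → V ∈ F → g ∈ U → g ∈ V → Exch U V → k ≤ (detours F g U V).ncard) :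
    (hamPaths {B ∈ F | g ∈ B} A B).ncard * ({B ∈ F | g ∈ B}.ncard - 1) * k ≤
      (hamPaths F A B).ncard := by
  classical
  set F₁ := {B ∈ F | g ∈ B} with hF₁
  rcases Nat.eq_zero_or_pos k with rfl | hkpos
  · simp
  let P := (finite_hamPaths F₁ A B).toFinset
  have hdet : ∀ l ∈ hamPaths F₁ A B, ∀ i < F₁.ncard - 1, ∃ Q : Finset (List (Set β)),
      Q.card = k ∧ ∀ q ∈ Q, (∃ X, q.head? = some X ∧ g ∉ X) ∧ (∀ Z ∈ q, g ∉ Z) ∧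
        IsHamPath F A B (l.take (i + 1) ++ (q ++ l.drop (i + 1))) := by
    intro l hl i hi
    have hlen := IsHamPath.length_eq hl
    obtain ⟨hUV, hlU, hlV⟩ := IsHamPath.exch_split hl (i := i) (by omega)
    set U := l[i]
    set V := l[i + 1]
    have hU : U ∈ F₁ := (IsHamPath.mem_iff hl _).1 (List.getElem_mem _)
    have hV : V ∈ F₁ := (IsHamPath.mem_iff hl _).1 (List.getElem_mem _)
    have h1 := hk U V hU.1 hV.1 hU.2 hV.2 hUV
    have hfin : (detours F g U V).Finite := Set.finite_of_ncard_pos (by omega)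
    rw [Set.ncard_eq_toFinset_card _ hfin] at h1
    obtain ⟨Q, hQ, hQk⟩ := Finset.exists_subset_card_eq h1
    refine ⟨Q, hQk, fun q hq => ?_⟩
    have hq' : q ∈ detours F g U V := hfin.mem_toFinset.1 (hQ hq)
    refine ⟨?_, ?_, IsHamPath.insert_detour ((List.take_append_drop _ _).symm ▸ hl) hlU hlV hq'⟩
    · obtain ⟨X, Y, -, -, h⟩ := hq'
      exact ⟨X, h.head, h.left_mem.2⟩
    · obtain ⟨X, Y, -, -, h⟩ := hq'
      exact fun Z hZ => ((h.mem_iff Z).1 hZ).2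
  choose! Q hQk hQ using hdet
  let S := P.sigma fun l => (Finset.range (F₁.ncard - 1)).sigma fun i => Q l i
  have hS : S.card = (hamPaths F₁ A B).ncard * (F₁.ncard - 1) * k := by
    rw [Finset.card_sigma, Set.ncard_eq_toFinset_card _ (finite_hamPaths F₁ A B), mul_assoc]
    refine Finset.sum_const_nat fun l hl => ?_
    rw [Finset.card_sigma]
    have hl' := (finite_hamPaths F₁ A B).mem_toFinset.1 hl
    rw [Finset.sum_const_nat (m := k) fun i hi => hQk l hl' i (Finset.mem_range.1 hi),
      Finset.card_range]
  rw [← hS, ← Set.ncard_coe_finset]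
  refine Set.ncard_le_ncard_of_injOn
    (fun t => t.1.take (t.2.1 + 1) ++ (t.2.2 ++ t.1.drop (t.2.1 + 1))) ?_ ?_
    (finite_hamPaths F A B)
  · rintro ⟨l, i, q⟩ h
    simp only [S, P, Finset.mem_coe, Finset.mem_sigma, Set.Finite.mem_toFinset,
      Finset.mem_range] at h
    exact (hQ l h.1 i h.2.1 q h.2.2).2.2
  -- Injectivity: membership of `g` separates `l` from `q`, and the first set without `g` marks the
  -- place of insertion.
  · have key : ∀ l i q, l ∈ hamPaths F₁ A B → i < F₁.ncard - 1 → q ∈ Q l i →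
        (l.take (i + 1) ++ (q ++ l.drop (i + 1))).filter (g ∈ ·) = l ∧
        (l.take (i + 1) ++ (q ++ l.drop (i + 1))).filter (g ∉ ·) = q ∧
        ((l.take (i + 1) ++ (q ++ l.drop (i + 1))).takeWhile (g ∈ ·)).length = i + 1 := by
      intro l i q hl hi hq
      obtain ⟨⟨X, hX, hgX⟩, hall, -⟩ := hQ l hl i hi q hq
      have hlg : ∀ Z ∈ l, g ∈ Z := fun Z hZ => ((IsHamPath.mem_iff hl Z).1 hZ).2
      have ht : ∀ Z ∈ l.take (i + 1), g ∈ Z := fun Z hZ => hlg Z (List.mem_of_mem_take hZ)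
      have hd : ∀ Z ∈ l.drop (i + 1), g ∈ Z := fun Z hZ => hlg Z (List.mem_of_mem_drop hZ)
      refine ⟨?_, ?_, ?_⟩
      · have e1 : (l.take (i + 1)).filter (g ∈ ·) = l.take (i + 1) :=
          List.filter_eq_self.2 (by simpa using ht)
        have e2 : (l.drop (i + 1)).filter (g ∈ ·) = l.drop (i + 1) :=
          List.filter_eq_self.2 (by simpa using hd)
        have e3 : q.filter (g ∈ ·) = [] := List.filter_eq_nil_iff.2 (by simpa using hall)
        rw [List.filter_append, List.filter_append, e1, e2, e3, List.nil_append,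
          List.take_append_drop]
      · have e1 : (l.take (i + 1)).filter (g ∉ ·) = [] :=
          List.filter_eq_nil_iff.2 (by simpa using ht)
        have e2 : (l.drop (i + 1)).filter (g ∉ ·) = [] :=
          List.filter_eq_nil_iff.2 (by simpa using hd)
        have e3 : q.filter (g ∉ ·) = q := List.filter_eq_self.2 (by simpa using hall)
        rw [List.filter_append, List.filter_append, e1, e2, e3, List.nil_append, List.append_nil]
      · rw [List.takeWhile_append_of_pos (by simpa using ht)]
        obtain ⟨q', rfl⟩ : ∃ q', q = X :: q' := List.head?_eq_some_iff.1 hX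
        rw [List.cons_append, List.takeWhile_cons_of_neg (by simpa using hgX), List.append_nil,
          List.length_take, IsHamPath.length_eq hl]
        omega
    rintro ⟨l, i, q⟩ h ⟨l', i', q'⟩ h' heq
    simp only [S, P, Finset.mem_coe, Finset.mem_sigma, Set.Finite.mem_toFinset,
      Finset.mem_range] at h h' heq
    obtain ⟨h1, h2, h3⟩ := key l i q h.1 h.2.1 h.2.2
    obtain ⟨h1', h2', h3'⟩ := key l' i' q' h'.1 h'.2.1 h'.2.2
    rw [heq] at h1 h2 h3
    obtain rfl := h1.symm.trans h1'
    obtain rfl := h2.symm.trans h2'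
    obtain rfl : i = i' := by omega
    rfl

end SetFamily

/-! ### Exits and the Harary–Holzmann theorem. -/

namespace SetFamily

theorem IsBasisFamily.eq_of_subset {β : Type*} {F : Set (Set β)} (h : IsBasisFamily F)
    {U V : Set β} (hU : U ∈ F) (hV : V ∈ F) (hUV : U ⊆ V) : U = V := by
  refine hUV.antisymm fun b hb => ?_
  by_contra hbU
  obtain ⟨a, ha, -⟩ := h.rev_exchange U hU V hV b ⟨hb, hbU⟩
  exact ha.2 (hUV ha.1)

/-- If all common elements of the adjacent members `A` and `B` lie in every member, then any two
members are adjacent. -/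
theorem IsBasisFamily.exch_of_common {β : Type*} {F : Set (Set β)} (h : IsBasisFamily F)
    {A B : Set β} (hA : A ∈ F) (hAB : Exch A B)
    (hI : ∀ g ∈ A, g ∈ B → ∀ C ∈ F, g ∈ C) {C D : Set β} (hC : C ∈ F) (hD : D ∈ F)
    (hCD : C ≠ D) : Exch C D := by
  obtain ⟨a, ha, b, hb, rfl⟩ := hAB
  -- Here `A \ {a}` is `A ∩ B`. As members form an antichain, each is this common part plus one
  -- element.
  have key : ∀ C ∈ F, ∃ c, c ∉ A \ {a} ∧ C = insert c (A \ {a}) := by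
    intro C hC
    have hsub : A \ {a} ⊆ C := fun g hg => hI g hg.1 (Or.inr hg) C hC
    by_cases haC : a ∈ C
    · refine ⟨a, fun h => h.2 rfl, ?_⟩
      rw [Set.insert_sdiff_self_of_mem ha]
      refine (h.eq_of_subset hA hC fun z hz => ?_).symm
      by_cases hza : z = a
      · exact hza ▸ haC
      · exact hsub ⟨hz, hza⟩
    · obtain ⟨c, hc, hcF⟩ := h.exchange A hA C hC a ⟨ha, haC⟩
      exact ⟨c, fun h => hc.2 h.1, (h.eq_of_subset hcF hC (Set.insert_subset hc.1 hsub)).symm⟩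
  obtain ⟨c, hc, rfl⟩ := key C hC
  obtain ⟨d, hd, rfl⟩ := key D hD
  refine ⟨c, Set.mem_insert _ _, d, ?_, ?_⟩
  · rintro (rfl | h')
    · exact hCD rfl
    · exact hd h'
  · rw [Set.insert_sdiff_self_of_notMem hc]

theorem exists_hamPath_of_forall_exch {β : Type*} {F : Set (Set β)} (hF : F.Finite)
    (h : ∀ C ∈ F, ∀ D ∈ F, C ≠ D → Exch C D) {A B : Set β} (hA : A ∈ F) (hB : B ∈ F)
    (hAB : A ≠ B) : (hamPaths F A B).Nonempty := by
  classical
  have hfin : (F \ {A, B}).Finite := hF.subset Set.sdiff_subset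
  have hm : ∀ X, X ∈ hfin.toFinset.toList ↔ X ∈ F ∧ X ≠ A ∧ X ≠ B := by
    intro X
    simp
  have hmem : ∀ X, X ∈ A :: (hfin.toFinset.toList ++ [B]) ↔ X ∈ F := by
    intro X
    simp only [List.mem_cons, List.mem_append, hm, List.not_mem_nil, or_false]
    constructor
    · rintro (rfl | h | rfl)
      exacts [hA, h.1, hB]
    · intro hX
      tauto
  have hnd : (A :: (hfin.toFinset.toList ++ [B])).Nodup := by
    rw [List.nodup_cons, List.nodup_append']
    refine ⟨?_, Finset.nodup_toList _, List.nodup_singleton _, ?_⟩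
    · simp [hAB]
    · intro X hX hX'
      exact ((hm X).1 hX).2.2 (List.mem_singleton.1 hX')
  refine ⟨_, hnd, hmem, ?_, rfl, by simp [List.getLast?_cons]⟩
  refine List.Pairwise.isChain (List.Pairwise.imp_of_mem ?_ hnd)
  exact fun hX hY hne => h _ ((hmem _).1 hX) _ ((hmem _).1 hY) hne

/-- The pairs of adjacent members avoiding `g` that are joined to `U` and to `V`. -/
def IsExit {β : Type*} (F : Set (Set β)) (g : β) (U V X Y : Set β) : Prop :=
  X ∈ F ∧ Y ∈ F ∧ g ∉ X ∧ g ∉ Y ∧ Exch U X ∧ Exch Y V ∧ Exch X Y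

theorem IsBasisFamily.exists_insert {β : Type*} {F : Set (Set β)} (h : IsBasisFamily F) {g : β}
    {U C : Set β} (hU : U ∈ F) (hC : C ∈ F) (hgU : g ∈ U) (hgC : g ∉ C) :
    ∃ x, x ∉ U ∧ x ∈ C ∧ insert x (U \ {g}) ∈ F := by
  obtain ⟨x, hx, hxF⟩ := h.exchange U hU C hC g ⟨hgU, hgC⟩
  exact ⟨x, hx.2, hx.1, hxF⟩

theorem notMem_insert_sdiff {β : Type*} {g x : β} {U : Set β} (hg : g ∈ U) (hx : x ∉ U) :
    g ∉ insert x (U \ {g}) := by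
  rintro (rfl | h)
  · exact hx hg
  · exact h.2 rfl

section

variable {β : Type*} {F : Set (Set β)} {g a b : β} {U : Set β}

theorem insert_sdiff_swap (ha : a ∈ U) (hgb : g ≠ b) (hga : g ≠ a) :
    insert a ((insert b (U \ {a})) \ {g}) = insert b (U \ {g}) := by
  ext z
  simp only [Set.mem_insert_iff, Set.mem_sdiff, Set.mem_singleton_iff]
  grind

/-- Exchanging `g` out of `V` towards `U - g + x` brings in `x` or `a`. The choice `a` would produce
`U - g + b`, which is excluded, so the same `x` replaces `g` in both `U` and `V`. -/
theorem IsBasisFamily.isExit_same (h : IsBasisFamily F) (ha : a ∈ U) (hb : b ∉ U) (hg : g ∈ U)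
    (hga : g ≠ a) (hV : insert b (U \ {a}) ∈ F) (hbF : insert b (U \ {g}) ∉ F) {x : β}
    (hx : x ∉ U) (hxF : insert x (U \ {g}) ∈ F) :
    IsExit F g U (insert b (U \ {a})) (insert x (U \ {g}))
      (insert x ((insert b (U \ {a})) \ {g})) := by
  have hgb : g ≠ b := fun h => hb (h ▸ hg)
  have hxb : x ≠ b := fun h => hbF (h ▸ hxF)
  have hxa : x ≠ a := fun h => hx (h ▸ ha)
  have hxg : x ≠ g := fun h => hx (h ▸ hg)
  have hgV : g ∈ insert b (U \ {a}) := Or.inr ⟨hg, hga⟩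
  have hxV : x ∉ insert b (U \ {a}) := by
    rintro (h | h)
    exacts [hxb h, hx h.1]
  have hgX := notMem_insert_sdiff hg hx
  obtain ⟨y, hyV, hyX, hyF⟩ := h.exists_insert hV hxF hgV hgX
  have hy : y = x := by
    rcases hyX with h' | h'
    · exact h'
    · exfalso
      have hya : y = a := by
        by_contra hne
        exact hyV (Or.inr ⟨h'.1, hne⟩)
      rw [hya, insert_sdiff_swap ha hgb hga] at hyF
      exact hbF hyF
  subst hy
  refine ⟨hxF, hyF, hgX, notMem_insert_sdiff hgV hyV, ⟨g, hg, y, hx, rfl⟩,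
    Exch.symm ⟨g, hgV, y, hyV, rfl⟩, a, Or.inr ⟨ha, hga.symm⟩, b, ?_, ?_⟩
  · rintro (h | h)
    exacts [hxb h.symm, hb h.1]
  · ext z
    simp only [Set.mem_insert_iff, Set.mem_sdiff, Set.mem_singleton_iff]
    grind

/-- When `U - g + b = V - g + a` is a member, it is a common neighbour of `U` and `V`. It serves as
`X` here and as `Y` in `isExit_right`; the other end replaces `g` by a further element. -/
theorem isExit_left (ha : a ∈ U) (hb : b ∉ U) (hg : g ∈ U)
    (hga : g ≠ a) (hbF : insert b (U \ {g}) ∈ F) {y : β}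
    (hy : y ∉ insert b (U \ {a})) (hya : y ≠ a)
    (hyF : insert y ((insert b (U \ {a})) \ {g}) ∈ F) :
    IsExit F g U (insert b (U \ {a})) (insert b (U \ {g}))
      (insert y ((insert b (U \ {a})) \ {g})) := by
  have hgb : g ≠ b := fun h => hb (h ▸ hg)
  have hgV : g ∈ insert b (U \ {a}) := Or.inr ⟨hg, hga⟩
  have hyU : y ∉ U := fun h => hy (Or.inr ⟨h, hya⟩)
  have hyb : y ≠ b := fun h => hy (Or.inl h)
  refine ⟨hbF, hyF, notMem_insert_sdiff hg hb, notMem_insert_sdiff hgV hy, ⟨g, hg, b, hb, rfl⟩,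
    Exch.symm ⟨g, hgV, y, hy, rfl⟩, a, Or.inr ⟨ha, hga.symm⟩, y, ?_, ?_⟩
  · rintro (h | h)
    exacts [hyb h, hyU h.1]
  · ext z
    simp only [Set.mem_insert_iff, Set.mem_sdiff, Set.mem_singleton_iff]
    grind

theorem isExit_right (ha : a ∈ U) (hb : b ∉ U) (hg : g ∈ U)
    (hga : g ≠ a) (hbF : insert b (U \ {g}) ∈ F) {x : β}
    (hx : x ∉ U) (hxb : x ≠ b) (hxF : insert x (U \ {g}) ∈ F) :
    IsExit F g U (insert b (U \ {a})) (insert x (U \ {g})) (insert b (U \ {g})) := by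
  have hgb : g ≠ b := fun h => hb (h ▸ hg)
  refine ⟨hxF, hbF, notMem_insert_sdiff hg hx, notMem_insert_sdiff hg hb, ⟨g, hg, x, hx, rfl⟩,
    ⟨a, Or.inr ⟨ha, hga.symm⟩, g, notMem_insert_sdiff hg hb, ?_⟩,
    x, Or.inl rfl, b, ?_, ?_⟩
  · ext z
    simp only [Set.mem_insert_iff, Set.mem_sdiff, Set.mem_singleton_iff]
    grind
  · rintro (h | h)
    exacts [hxb h.symm, hb h.1]
  · ext z
    simp only [Set.mem_insert_iff, Set.mem_sdiff, Set.mem_singleton_iff]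
    grind

end

theorem Exch.exists_insert_eq {β : Type*} {g : β} {U Z : Set β} (h : Exch U Z) (hgU : g ∈ U)
    (hgZ : g ∉ Z) : ∃ z, z ∉ U ∧ Z = insert z (U \ {g}) := by
  obtain ⟨w, hw, z, hz, rfl⟩ := h
  obtain rfl : g = w := by
    by_contra hne
    exact hgZ (Or.inr ⟨hgU, hne⟩)
  exact ⟨z, hz, rfl⟩

/-- Either an edge has an exit, or its ends have a single common neighbour avoiding `g`. -/
theorem IsBasisFamily.exists_isExit_or {β : Type*} {F : Set (Set β)} (h : IsBasisFamily F) {g : β}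
    {U V C : Set β} (hU : U ∈ F) (hV : V ∈ F) (hgU : g ∈ U) (hgV : g ∈ V) (hUV : Exch U V)
    (hC : C ∈ F) (hgC : g ∉ C) :
    (∃ X Y, IsExit F g U V X Y) ∨ ∃ X ∈ F, g ∉ X ∧ (∀ Z ∈ F, g ∉ Z → (Exch U Z ↔ Z = X)) ∧
      (∀ Z ∈ F, g ∉ Z → (Exch V Z ↔ Z = X)) := by
  obtain ⟨a, ha, b, hb, rfl⟩ := hUV
  have hgb : g ≠ b := fun h => hb (h ▸ hgU)
  have hga : g ≠ a := by
    rintro rfl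
    exact notMem_insert_sdiff ha hb hgV
  obtain ⟨x, hx, -, hxF⟩ := h.exists_insert hU hC hgU hgC
  by_cases hbF : insert b (U \ {g}) ∈ F
  swap
  · exact Or.inl ⟨_, _, h.isExit_same ha hb hgU hga hV hbF hx hxF⟩
  by_cases hL : ∃ y, y ∉ insert b (U \ {a}) ∧ y ≠ a ∧ insert y ((insert b (U \ {a})) \ {g}) ∈ F
  · obtain ⟨y, hy, hya, hyF⟩ := hL
    exact Or.inl ⟨_, _, isExit_left ha hb hgU hga hbF hy hya hyF⟩
  by_cases hR : ∃ x, x ∉ U ∧ x ≠ b ∧ insert x (U \ {g}) ∈ F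
  · obtain ⟨x, hx, hxb, hxF⟩ := hR
    exact Or.inl ⟨_, _, isExit_right ha hb hgU hga hbF hx hxb hxF⟩
  push Not at hL hR
  refine Or.inr ⟨_, hbF, notMem_insert_sdiff hgU hb, fun Z hZ hgZ => ⟨fun hUZ => ?_, ?_⟩,
    fun Z hZ hgZ => ⟨fun hVZ => ?_, ?_⟩⟩
  · obtain ⟨z, hz, rfl⟩ := hUZ.exists_insert_eq hgU hgZ
    by_cases hzb : z = b
    · rw [hzb]
    · exact absurd hZ (hR z hz hzb)
  · rintro rfl
    exact ⟨g, hgU, b, hb, rfl⟩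
  · obtain ⟨z, hz, rfl⟩ := hVZ.exists_insert_eq hgV hgZ
    by_cases hza : z = a
    · rw [hza, insert_sdiff_swap ha hgb hga]
    · exact absurd hZ (hL z hz hza)
  · rintro rfl
    exact ⟨g, hgV, a, notMem_insert_sdiff ha hb, (insert_sdiff_swap ha hgb hga).symm⟩

theorem Exch.ne {β : Type*} {U V : Set β} (h : Exch U V) : U ≠ V := by
  obtain ⟨a, ha, b, hb, rfl⟩ := h
  intro h'
  exact hb (h' ▸ Set.mem_insert _ _)

/-- The Harary–Holzmann theorem: every edge of a basis graph lies in a Hamiltonian cycle. -/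
theorem IsBasisFamily.nonempty_hamPaths {β : Type*} {F : Set (Set β)} (h : IsBasisFamily F)
    (hF : F.Finite) {A B : Set β} (hA : A ∈ F) (hB : B ∈ F) (hAB : Exch A B) :
    (hamPaths F A B).Nonempty := by
  induction hn : F.ncard using Nat.strong_induction_on generalizing F A B with
  | _ n ih =>
  subst hn
  -- If there is no `g` to branch on, the exchange graph is complete.
  by_cases hcom : ∀ g ∈ A, g ∈ B → ∀ C ∈ F, g ∈ C
  · exact exists_hamPath_of_forall_exch hF
      (fun C hC D hD hne => h.exch_of_common hA hAB hcom hC hD hne) hA hB hAB.ne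
  push Not at hcom
  obtain ⟨g, hgA, hgB, C, hC, hgC⟩ := hcom
  have h1 : {B ∈ F | g ∈ B}.ncard < F.ncard :=
    Set.ncard_lt_ncard ⟨Set.sep_subset _ _, fun hs => hgC (hs hC).2⟩ hF
  have h2 : {B ∈ F | g ∉ B}.ncard < F.ncard :=
    Set.ncard_lt_ncard ⟨Set.sep_subset _ _, fun hs => (hs hA).2 hgA⟩ hF
  obtain ⟨l, hl⟩ := ih _ h1 (h.sep_mem g) (hF.subset (Set.sep_subset _ _)) ⟨hA, hgA⟩ ⟨hB, hgB⟩
    hAB rfl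
  have hl' : IsHamPath {B ∈ F | g ∈ B} A B l := hl
  by_contra hno
  have hdet : ∀ i (hi : i + 1 < l.length), detours F g l[i] l[i + 1] = ∅ := by
    intro i hi
    rw [Set.eq_empty_iff_forall_notMem]
    intro q hq
    obtain ⟨-, hU, hV⟩ := hl'.exch_split hi
    exact hno ⟨_, IsHamPath.insert_detour ((List.take_append_drop (i + 1) l).symm ▸ hl') hU hV hq⟩
  have hmem : ∀ i (hi : i < l.length), l[i] ∈ F ∧ g ∈ l[i] :=
    fun i hi => (hl'.mem_iff _).1 (List.getElem_mem hi)
  have hcommon : ∀ i (hi : i + 1 < l.length), ∃ X ∈ F, g ∉ X ∧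
      (∀ Z ∈ F, g ∉ Z → (Exch l[i] Z ↔ Z = X)) ∧
      (∀ Z ∈ F, g ∉ Z → (Exch l[i + 1] Z ↔ Z = X)) := by
    intro i hi
    rcases h.exists_isExit_or (hmem i (by omega)).1 (hmem _ hi).1 (hmem i (by omega)).2
      (hmem _ hi).2 (hl'.exch_split hi).1 hC hgC with ⟨X, Y, hX, hY, hgX, hgY, hUX, hYV, hXY⟩ | h'
    · obtain ⟨q, hq⟩ := ih _ h2 (h.sep_notMem g) (hF.subset (Set.sep_subset _ _)) ⟨hX, hgX⟩
        ⟨hY, hgY⟩ hXY rfl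
      exact absurd (show q ∈ detours F g _ _ from ⟨X, Y, hUX, hYV, hq⟩) (by simp [hdet i hi])
    · exact h'
  have hlen : 0 + 1 < l.length := by
    have hAl := (hl'.mem_iff A).2 ⟨hA, hgA⟩
    have hBl := (hl'.mem_iff B).2 ⟨hB, hgB⟩
    rcases l with _ | ⟨Z, _ | ⟨Z', t⟩⟩
    · simp at hAl
    · simp only [List.mem_singleton] at hAl hBl
      exact absurd (hAl.trans hBl.symm) hAB.ne
    · simp
  obtain ⟨X, hX, hgX, hX0, hX1⟩ := hcommon 0 hlen
  -- Without exits, consecutive members share their only neighbour avoiding `g`, so it is the same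
  -- `X` along the whole path.
  have hall : ∀ i (hi : i < l.length), ∀ Z ∈ F, g ∉ Z → (Exch l[i] Z ↔ Z = X) := by
    intro i
    induction i with
    | zero => exact fun _ => hX0
    | succ i ihi =>
      intro hi Z hZ hgZ
      obtain ⟨X', hX', hgX', h0, h1⟩ := hcommon i hi
      have : X = X' := (h0 X hX hgX).1 ((ihi (by omega) X hX hgX).2 rfl)
      rw [this]
      exact h1 Z hZ hgZ
  -- Every member avoiding `g` has a neighbour containing `g`, and that neighbour lies on the path.
  -- So the deletion is `{X}`, and `X` alone is a detour.
  have hsing : ∀ Y, Y ∈ F ∧ g ∉ Y ↔ Y = X := by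
    refine fun Y => ⟨fun hY => ?_, fun hY => hY ▸ ⟨hX, hgX⟩⟩
    obtain ⟨a, ha, hZ⟩ := h.rev_exchange Y hY.1 A hA g ⟨hgA, hY.2⟩
    obtain ⟨i, hi, hiZ⟩ := List.getElem_of_mem ((hl'.mem_iff _).2 ⟨hZ, Set.mem_insert _ _⟩)
    refine (hall i hi Y hY.1 hY.2).1 ?_
    rw [hiZ]
    exact Exch.symm ⟨a, ha.1, g, hY.2, rfl⟩
  have : [X] ∈ detours F g l[0] l[0 + 1] := by
    refine ⟨X, X, (hX0 X hX hgX).2 rfl, ((hX1 X hX hgX).2 rfl).symm, List.nodup_singleton _, ?_,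
      List.isChain_singleton _, rfl, rfl⟩
    intro Z
    rw [List.mem_singleton, ← hsing]
    rfl
  simp [hdet 0 hlen] at this

end SetFamily

/-! ### Counting paths in thin and thick families. -/

namespace SetFamily

/-- Exchanging `g` into `C` adds nothing else. Hence avoidance conditions pass to the contraction by
`g`. -/
theorem IsBasisFamily.exists_mem_avoid {β : Type*} {F : Set (Set β)} (h : IsBasisFamily F) {g : β}
    {A C K : Set β} (hA : A ∈ F) (hgA : g ∈ A) (hC : C ∈ F) (hgK : g ∉ K) (hCK : Disjoint C K) :
    ∃ D ∈ F, g ∈ D ∧ Disjoint D K := by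
  by_cases hgC : g ∈ C
  · exact ⟨C, hC, hgC, hCK⟩
  obtain ⟨x, -, hx⟩ := h.rev_exchange C hC A hA g ⟨hgA, hgC⟩
  exact ⟨_, hx, Or.inl rfl,
    Set.disjoint_insert_left.2 ⟨hgK, hCK.mono_left Set.sdiff_subset⟩⟩

/-- A family without coloops outside the common part `I` has more members than its rank. -/
theorem IsBasisFamily.lt_ncard {β : Type*} {F : Set (Set β)} (h : IsBasisFamily F) (hF : F.Finite)
    {I : Set β} (havoid : ∀ a ∉ I, ∃ C ∈ F, a ∉ C) {A : Set β} (hA : A ∈ F) :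
    (A \ I).ncard < F.ncard := by
  have hex : ∀ e ∈ A \ I, ∃ x, x ∉ A ∧ insert x (A \ {e}) ∈ F := by
    intro e he
    obtain ⟨C, hC, heC⟩ := havoid e he.2
    obtain ⟨x, hx, -, hxF⟩ := h.exists_insert hA hC he.1 heC
    exact ⟨x, hx, hxF⟩
  choose! f hfA hfF using hex
  have himg : (fun e => insert (f e) (A \ {e})) '' (A \ I) ⊆ F := by
    rintro _ ⟨e, he, rfl⟩
    exact hfF e he
  -- The neighbour indexed by `e` is the only one of these that omits `e`.
  have hinj : Set.InjOn (fun e => insert (f e) (A \ {e})) (A \ I) := by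
    intro e he e' he' heq
    by_contra hne
    refine notMem_insert_sdiff he.1 (hfA e he) ?_
    change e ∈ (fun e => insert (f e) (A \ {e})) e
    rw [heq]
    exact Or.inr ⟨he.1, hne⟩
  have hnot : A ∉ (fun e => insert (f e) (A \ {e})) '' (A \ I) := by
    rintro ⟨e, he, heq⟩
    exact hfA e he ((Set.ext_iff.1 heq (f e)).1 (Set.mem_insert _ _))
  have h1 := Set.ncard_le_ncard (Set.insert_subset hA himg) hF
  rw [Set.ncard_insert_of_notMem hnot (hF.subset himg), hinj.ncard_image] at h1
  omega

/-- A finite basis family whose members contain `I`, without coloops outside `I`, in which no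
three elements outside `I` are in series. -/
structure IsThin {β : Type*} (F : Set (Set β)) (I : Set β) : Prop where
  isBasisFamily : IsBasisFamily F
  finite : F.Finite
  subset : ∀ B ∈ F, I ⊆ B
  avoid : ∀ a ∉ I, ∃ C ∈ F, a ∉ C
  avoid_pair : ∀ a ∉ I, ∀ b ∉ I, ∀ c ∉ I, a ≠ b → a ≠ c → b ≠ c →
    (∃ C ∈ F, Disjoint C {a, b}) ∨ ∃ C ∈ F, Disjoint C {a, c}

theorem IsThin.contract {β : Type*} {F : Set (Set β)} {I A : Set β} (h : IsThin F I) {g : β}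
    (hA : A ∈ F) (hgA : g ∈ A) : IsThin {B ∈ F | g ∈ B} (insert g I) where
  isBasisFamily := h.isBasisFamily.sep_mem g
  finite := h.finite.subset (Set.sep_subset _ _)
  subset := fun B hB => Set.insert_subset hB.2 (h.subset B hB.1)
  avoid := by
    intro a ha
    rw [Set.mem_insert_iff, not_or] at ha
    obtain ⟨C, hC, haC⟩ := h.avoid a ha.2
    obtain ⟨D, hD, hgD, haD⟩ := h.isBasisFamily.exists_mem_avoid (K := {a}) hA hgA hC
      (fun h' => ha.1 h'.symm) (Set.disjoint_singleton_right.2 haC)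
    exact ⟨D, ⟨hD, hgD⟩, Set.disjoint_singleton_right.1 haD⟩
  avoid_pair := by
    intro a ha b hb c hc hab hac hbc
    rw [Set.mem_insert_iff, not_or] at ha hb hc
    refine (h.avoid_pair a ha.2 b hb.2 c hc.2 hab hac hbc).imp ?_ ?_
    · rintro ⟨C, hC, hd⟩
      obtain ⟨D, hD, hgD, haD⟩ := h.isBasisFamily.exists_mem_avoid hA hgA hC
        (by simp [Ne.symm ha.1, Ne.symm hb.1]) hd
      exact ⟨D, ⟨hD, hgD⟩, haD⟩
    · rintro ⟨C, hC, hd⟩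
      obtain ⟨D, hD, hgD, haD⟩ := h.isBasisFamily.exists_mem_avoid hA hgA hC
        (by simp [Ne.symm ha.1, Ne.symm hc.1]) hd
      exact ⟨D, ⟨hD, hgD⟩, haD⟩

/-- If `U - g + b` is a member, then since `g`, `a`, `b` are not in series, some member avoids `{g,
a}` or `{g, b}`; this supplies the second element for a left or a right exit. -/
theorem IsThin.exists_isExit {β : Type*} {F : Set (Set β)} {I U V : Set β} (h : IsThin F I)
    {g : β} (hgI : g ∉ I) (hU : U ∈ F) (hV : V ∈ F) (hgU : g ∈ U) (hgV : g ∈ V)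
    (hUV : Exch U V) : ∃ X Y, IsExit F g U V X Y := by
  obtain ⟨a, ha, b, hb, rfl⟩ := hUV
  have hgb : g ≠ b := fun h => hb (h ▸ hgU)
  have haV := notMem_insert_sdiff ha hb
  have hga : g ≠ a := fun h => haV (h ▸ hgV)
  have hab : a ≠ b := fun h => hb (h ▸ ha)
  by_cases hbF : insert b (U \ {g}) ∈ F
  · rcases h.avoid_pair g hgI a (fun h' => haV (h.subset _ hV h')) b
      (fun h' => hb (h.subset _ hU h')) hga hgb hab with ⟨C, hC, hd⟩ | ⟨C, hC, hd⟩
    · rw [Set.disjoint_insert_right, Set.disjoint_singleton_right] at hd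
      obtain ⟨y, hy, hyC, hyF⟩ := h.isBasisFamily.exists_insert hV hC hgV hd.1
      exact ⟨_, _, isExit_left ha hb hgU hga hbF hy (fun h' => hd.2 (h' ▸ hyC)) hyF⟩
    · rw [Set.disjoint_insert_right, Set.disjoint_singleton_right] at hd
      obtain ⟨x, hx, hxC, hxF⟩ := h.isBasisFamily.exists_insert hU hC hgU hd.1
      exact ⟨_, _, isExit_right ha hb hgU hga hbF hx (fun h' => hd.2 (h' ▸ hxC)) hxF⟩
  · obtain ⟨C, hC, hgC⟩ := h.avoid g hgI
    obtain ⟨x, hx, -, hxF⟩ := h.isBasisFamily.exists_insert hU hC hgU hgC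
    exact ⟨_, _, h.isBasisFamily.isExit_same ha hb hgU hga hV hbF hx hxF⟩

theorem exists_mem_inter_notMem {β : Type*} {A B I : Set β} (hAB : Exch A B)
    (hA : 1 < (A \ I).ncard) : ∃ g, g ∈ A ∧ g ∈ B ∧ g ∉ I := by
  obtain ⟨a, ha, b, hb, rfl⟩ := hAB
  obtain ⟨g, hg, hga⟩ := Set.exists_ne_of_one_lt_ncard hA a
  exact ⟨g, hg.1, Or.inr ⟨hg.1, hga⟩, hg.2⟩

theorem le_ncard_sdiff_insert {β : Type*} {B I : Set β} {g : β} {r : ℕ}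
    (h : r + 1 ≤ (B \ I).ncard) : r ≤ (B \ insert g I).ncard := by
  have := Set.pred_ncard_le_ncard_sdiff_singleton (B \ I) g
  rw [Set.sdiff_sdiff, Set.union_singleton] at this
  omega

theorem IsBasisFamily.one_le_ncard_hamPaths {β : Type*} {F : Set (Set β)} (h : IsBasisFamily F)
    (hF : F.Finite) {A B : Set β} (hA : A ∈ F) (hB : B ∈ F) (hAB : Exch A B) :
    1 ≤ (hamPaths F A B).ncard :=
  (Set.ncard_pos (finite_hamPaths F A B)).2 (h.nonempty_hamPaths hF hA hB hAB)

theorem finite_detours {β : Type*} {F : Set (Set β)} (hF : F.Finite) (g : β) (U V : Set β) :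
    (detours F g U V).Finite := by
  refine (Set.Finite.biUnion hF fun X _ => Set.Finite.biUnion hF fun Y _ =>
    finite_hamPaths {B ∈ F | g ∉ B} X Y).subset ?_
  rintro q ⟨X, Y, -, -, hq⟩
  exact Set.mem_biUnion hq.left_mem.1 (Set.mem_biUnion hq.right_mem.1 hq)

/-- One detour per edge suffices: the factorial comes from the number of edges available at each
contraction. -/
theorem IsThin.factorial_le_ncard_hamPaths {β : Type*} (r : ℕ) {F : Set (Set β)} {I A B : Set β}
    (h : IsThin F I) (hr : ∀ B ∈ F, r ≤ (B \ I).ncard) (hA : A ∈ F) (hB : B ∈ F)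
    (hAB : Exch A B) : (r - 1).factorial ≤ (hamPaths F A B).ncard := by
  induction r generalizing F I A B with
  | zero => exact h.isBasisFamily.one_le_ncard_hamPaths h.finite hA hB hAB
  | succ r ih =>
    rcases r with _ | k
    · exact h.isBasisFamily.one_le_ncard_hamPaths h.finite hA hB hAB
    obtain ⟨g, hgA, hgB, hgI⟩ := exists_mem_inter_notMem (I := I) hAB
      (by have := hr A hA; omega)
    have h₁ := h.contract hA hgA
    have hr₁ : ∀ B ∈ {B ∈ F | g ∈ B}, k + 1 ≤ (B \ insert g I).ncard :=
      fun B hB => le_ncard_sdiff_insert (hr B hB.1)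
    have hih := ih h₁ hr₁ ⟨hA, hgA⟩ ⟨hB, hgB⟩ hAB
    have hcard := h₁.isBasisFamily.lt_ncard h₁.finite h₁.avoid ⟨hA, hgA⟩
    have hrA := hr₁ A ⟨hA, hgA⟩
    refine le_trans ?_ (mul_le_ncard_hamPaths (F := F) (g := g) (k := 1) ?_)
    · rw [Nat.add_sub_cancel] at hih ⊢
      rw [Nat.factorial_succ, mul_one, mul_comm]
      exact Nat.mul_le_mul hih (by omega)
    · intro U V hU hV hgU hgV hUV
      obtain ⟨X, Y, hX, hY, hgX, hgY, hUX, hYV, hXY⟩ := h.exists_isExit hgI hU hV hgU hgV hUV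
      have h₂ := (h.isBasisFamily.sep_notMem g).one_le_ncard_hamPaths
        (h.finite.subset (Set.sep_subset _ _)) ⟨hX, hgX⟩ ⟨hY, hgY⟩ hXY
      refine h₂.trans (Set.ncard_le_ncard (fun q hq => ⟨X, Y, hUX, hYV, hq⟩)
        (finite_detours h.finite g U V))

/-- A finite basis family whose members contain `I`, in which every cocircuit avoiding `I` has at
least three elements, and distinct three-element cocircuits avoiding `I` share at most one
element. -/
structure IsThick {β : Type*} (F : Set (Set β)) (I : Set β) : Prop where
  isBasisFamily : IsBasisFamily F
  finite : F.Finite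
  subset : ∀ B ∈ F, I ⊆ B
  avoid_pair : ∀ a ∉ I, ∀ b ∉ I, ∃ C ∈ F, Disjoint C {a, b}
  avoid_triple : ∀ g ∉ I, ∀ a ∉ I, ∀ b ∉ I, ∀ c ∉ I, g ≠ a → g ≠ b → g ≠ c → a ≠ b → a ≠ c →
    b ≠ c → (∃ C ∈ F, Disjoint C {g, a, b}) ∨ ∃ C ∈ F, Disjoint C {g, a, c}

theorem IsThick.avoid {β : Type*} {F : Set (Set β)} {I : Set β} (h : IsThick F I) :
    ∀ a ∉ I, ∃ C ∈ F, a ∉ C := by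
  intro a ha
  obtain ⟨C, hC, hd⟩ := h.avoid_pair a ha a ha
  rw [Set.disjoint_insert_right] at hd
  exact ⟨C, hC, hd.1⟩

theorem IsThick.contract {β : Type*} {F : Set (Set β)} {I A : Set β} (h : IsThick F I) {g : β}
    (hA : A ∈ F) (hgA : g ∈ A) : IsThick {B ∈ F | g ∈ B} (insert g I) where
  isBasisFamily := h.isBasisFamily.sep_mem g
  finite := h.finite.subset (Set.sep_subset _ _)
  subset := fun B hB => Set.insert_subset hB.2 (h.subset B hB.1)
  avoid_pair := by
    intro a ha b hb
    rw [Set.mem_insert_iff, not_or] at ha hb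
    obtain ⟨C, hC, hd⟩ := h.avoid_pair a ha.2 b hb.2
    obtain ⟨D, hD, hgD, haD⟩ := h.isBasisFamily.exists_mem_avoid hA hgA hC
      (by simp [Ne.symm ha.1, Ne.symm hb.1]) hd
    exact ⟨D, ⟨hD, hgD⟩, haD⟩
  avoid_triple := by
    intro x hx a ha b hb c hc hxa hxb hxc hab hac hbc
    rw [Set.mem_insert_iff, not_or] at hx ha hb hc
    refine (h.avoid_triple x hx.2 a ha.2 b hb.2 c hc.2 hxa hxb hxc hab hac hbc).imp ?_ ?_
    · rintro ⟨C, hC, hd⟩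
      obtain ⟨D, hD, hgD, haD⟩ := h.isBasisFamily.exists_mem_avoid hA hgA hC
        (by simp [Ne.symm hx.1, Ne.symm ha.1, Ne.symm hb.1]) hd
      exact ⟨D, ⟨hD, hgD⟩, haD⟩
    · rintro ⟨C, hC, hd⟩
      obtain ⟨D, hD, hgD, haD⟩ := h.isBasisFamily.exists_mem_avoid hA hgA hC
        (by simp [Ne.symm hx.1, Ne.symm ha.1, Ne.symm hc.1]) hd
      exact ⟨D, ⟨hD, hgD⟩, haD⟩

/-- A member avoiding `{g, x, y}` is a member of the deletion avoiding `{x, y}`. If `g` is itself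
one of the three elements, `avoid_pair` already suffices. -/
theorem IsThick.isThin_delete {β : Type*} {F : Set (Set β)} {I : Set β} (h : IsThick F I) {g : β}
    (hg : g ∉ I) : IsThin {B ∈ F | g ∉ B} I where
  isBasisFamily := h.isBasisFamily.sep_notMem g
  finite := h.finite.subset (Set.sep_subset _ _)
  subset := fun B hB => h.subset B hB.1
  avoid := by
    intro a ha
    obtain ⟨C, hC, hd⟩ := h.avoid_pair g hg a ha
    rw [Set.disjoint_insert_right, Set.disjoint_singleton_right] at hd
    exact ⟨C, ⟨hC, hd.1⟩, hd.2⟩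
  avoid_pair := by
    intro a ha b hb c hc hab hac hbc
    have key : ∀ x ∉ I, ∀ y ∉ I, g = x ∨ g = y → ∃ C ∈ {B ∈ F | g ∉ B}, Disjoint C {x, y} := by
      intro x hx y hy hgxy
      obtain ⟨C, hC, hd⟩ := h.avoid_pair x hx y hy
      refine ⟨C, ⟨hC, ?_⟩, hd⟩
      rw [Set.disjoint_insert_right, Set.disjoint_singleton_right] at hd
      rcases hgxy with rfl | rfl
      exacts [hd.1, hd.2]
    by_cases hga : g = a
    · exact Or.inl (key a ha b hb (Or.inl hga))
    by_cases hgb : g = b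
    · exact Or.inl (key a ha b hb (Or.inr hgb))
    by_cases hgc : g = c
    · exact Or.inr (key a ha c hc (Or.inr hgc))
    refine (h.avoid_triple g hg a ha b hb c hc hga hgb hgc hab hac hbc).imp ?_ ?_
    all_goals
      rintro ⟨C, hC, hd⟩
      rw [Set.disjoint_insert_right] at hd
      exact ⟨C, ⟨hC, hd.1⟩, hd.2⟩

/-- If `U - g + b` is a member, there are both a left and a right exit. Otherwise any replacement of
`g` in `U` gives an exit, and avoiding `{g, x}` provides a second one besides `x`. -/
theorem IsThick.exists_two_isExit {β : Type*} {F : Set (Set β)} {I U V : Set β} (h : IsThick F I)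
    {g : β} (hgI : g ∉ I) (hU : U ∈ F) (hV : V ∈ F) (hgU : g ∈ U) (hgV : g ∈ V)
    (hUV : Exch U V) :
    ∃ X Y X' Y', IsExit F g U V X Y ∧ IsExit F g U V X' Y' ∧ X ≠ X' := by
  obtain ⟨a, ha, b, hb, rfl⟩ := hUV
  have haV := notMem_insert_sdiff ha hb
  have hga : g ≠ a := fun h => haV (h ▸ hgV)
  have hne : ∀ {x x'}, x ∉ U → x ≠ x' → insert x (U \ {g}) ≠ insert x' (U \ {g}) := by
    intro x x' hx hxx' heq
    have : x ∈ insert x' (U \ {g}) := heq ▸ Set.mem_insert x _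
    rcases this with h' | h'
    exacts [hxx' h', hx h'.1]
  by_cases hbF : insert b (U \ {g}) ∈ F
  · obtain ⟨C, hC, hd⟩ := h.avoid_pair g hgI a (fun h' => haV (h.subset _ hV h'))
    obtain ⟨D, hD, hd'⟩ := h.avoid_pair g hgI b (fun h' => hb (h.subset _ hU h'))
    rw [Set.disjoint_insert_right, Set.disjoint_singleton_right] at hd hd'
    obtain ⟨y, hy, hyC, hyF⟩ := h.isBasisFamily.exists_insert hV hC hgV hd.1
    obtain ⟨x, hx, hxD, hxF⟩ := h.isBasisFamily.exists_insert hU hD hgU hd'.1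
    have hxb : x ≠ b := fun h' => hd'.2 (h' ▸ hxD)
    exact ⟨_, _, _, _, isExit_right ha hb hgU hga hbF hx hxb hxF,
      isExit_left ha hb hgU hga hbF hy (fun h' => hd.2 (h' ▸ hyC)) hyF, hne hx hxb⟩
  · obtain ⟨C, hC, hgC⟩ := h.avoid g hgI
    obtain ⟨x, hx, -, hxF⟩ := h.isBasisFamily.exists_insert hU hC hgU hgC
    obtain ⟨D, hD, hd⟩ := h.avoid_pair g hgI x (fun h' => hx (h.subset _ hU h'))
    rw [Set.disjoint_insert_right, Set.disjoint_singleton_right] at hd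
    obtain ⟨x', hx', hxD', hxF'⟩ := h.isBasisFamily.exists_insert hU hD hgU hd.1
    exact ⟨_, _, _, _, h.isBasisFamily.isExit_same ha hb hgU hga hV hbF hx hxF,
      h.isBasisFamily.isExit_same ha hb hgU hga hV hbF hx' hxF',
      hne hx fun h' => hd.2 (h' ▸ hxD')⟩

theorem two_pow_le_factorial_succ (k : ℕ) : 2 ^ k ≤ (k + 1).factorial := by
  induction k with
  | zero => rfl
  | succ k ih =>
    rw [Nat.factorial_succ, pow_succ, mul_comm]
    exact Nat.mul_le_mul (by omega) ih

theorem IsThick.le_ncard_hamPaths {β : Type*} (r : ℕ) {F : Set (Set β)} {I A B : Set β}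
    (h : IsThick F I) (hr : ∀ B ∈ F, r ≤ (B \ I).ncard) (hA : A ∈ F) (hB : B ∈ F)
    (hAB : Exch A B) : (r - 1).factorial * 2 ^ r.choose 2 ≤ (hamPaths F A B).ncard := by
  induction r generalizing F I A B with
  | zero => exact h.isBasisFamily.one_le_ncard_hamPaths h.finite hA hB hAB
  | succ r ih =>
    rcases r with _ | k
    · exact h.isBasisFamily.one_le_ncard_hamPaths h.finite hA hB hAB
    obtain ⟨g, hgA, hgB, hgI⟩ := exists_mem_inter_notMem (I := I) hAB
      (by have := hr A hA; omega)
    have h₁ := h.contract hA hgA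
    have h₂ := h.isThin_delete hgI
    have hr₁ : ∀ B ∈ {B ∈ F | g ∈ B}, k + 1 ≤ (B \ insert g I).ncard :=
      fun B hB => le_ncard_sdiff_insert (hr B hB.1)
    have hih := ih h₁ hr₁ ⟨hA, hgA⟩ ⟨hB, hgB⟩ hAB
    have hcard := h₁.isBasisFamily.lt_ncard h₁.finite h₁.avoid ⟨hA, hgA⟩
    have hrA := hr₁ A ⟨hA, hgA⟩
    refine le_trans ?_ (mul_le_ncard_hamPaths (F := F) (g := g) (k := 2 ^ (k + 1)) ?_)
    · have hc : (k + 1 + 1).choose 2 = (k + 1) + (k + 1).choose 2 := by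
        rw [Nat.choose_succ_succ' (k + 1) 1, Nat.choose_one_right]
      rw [Nat.add_sub_cancel] at hih ⊢
      rw [hc, pow_add, Nat.factorial_succ]
      calc (k + 1) * k.factorial * (2 ^ (k + 1) * 2 ^ (k + 1).choose 2)
          = (k.factorial * 2 ^ (k + 1).choose 2) * (k + 1) * 2 ^ (k + 1) := by ring
        _ ≤ _ := Nat.mul_le_mul_right _ (Nat.mul_le_mul hih (by omega))
    · intro U V hU hV hgU hgV hUV
      obtain ⟨X, Y, X', Y', ⟨hX, hY, hgX, hgY, hUX, hYV, hXY⟩,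
        ⟨hX', hY', hgX', hgY', hUX', hYV', hXY'⟩, hne⟩ :=
        h.exists_two_isExit hgI hU hV hgU hgV hUV
      -- Deletion keeps the rank bound, so each of the two exits yields `(k + 1)!` detours, and `2 *
      -- (k + 1)! ≥ 2 ^ (k + 1)`.
      have hr₂ : ∀ B ∈ {B ∈ F | g ∉ B}, k + 1 + 1 ≤ (B \ I).ncard := fun B hB => hr B hB.1
      have e₁ := h₂.factorial_le_ncard_hamPaths _ hr₂ ⟨hX, hgX⟩ ⟨hY, hgY⟩ hXY
      have e₂ := h₂.factorial_le_ncard_hamPaths _ hr₂ ⟨hX', hgX'⟩ ⟨hY', hgY'⟩ hXY'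
      rw [Nat.add_sub_cancel] at e₁ e₂
      have hdis : Disjoint (hamPaths {B ∈ F | g ∉ B} X Y) (hamPaths {B ∈ F | g ∉ B} X' Y') := by
        rw [Set.disjoint_left]
        intro q hq hq'
        exact hne (Option.some.inj ((IsHamPath.head hq).symm.trans (IsHamPath.head hq')))
      have hle : hamPaths {B ∈ F | g ∉ B} X Y ∪ hamPaths {B ∈ F | g ∉ B} X' Y' ⊆
          detours F g U V := by
        rintro q (hq | hq)
        exacts [⟨X, Y, hUX, hYV, hq⟩, ⟨X', Y', hUX', hYV', hq⟩]
      have h3 := Set.ncard_le_ncard hle (finite_detours h.finite g U V)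
      rw [Set.ncard_union_eq hdis (finite_hamPaths _ _ _) (finite_hamPaths _ _ _)] at h3
      have h4 := two_pow_le_factorial_succ k
      rw [pow_succ]
      omega

end SetFamily

/-! ### From Hamiltonian paths of bases to Hamiltonian cycles of the basis graph. -/

namespace SimpleGraph

/-- The first edge is the only edge of a path at its starting vertex, so the path can be recovered
step by step. This makes the passage from paths to edge sets of cycles injective. -/
theorem Walk.IsPath.eq_of_edges {W : Type*} {H : SimpleGraph W} {x y : W} {p q : H.Walk x y}
    (hp : p.IsPath) (hq : q.IsPath) (h : ∀ e, e ∈ p.edges ↔ e ∈ q.edges) : p = q := by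
  induction p with
  | nil => exact (Walk.eq_nil_iff_nil.2 (Walk.isPath_iff_nil.1 hq)).symm
  | @cons x c y hxc p ih =>
    cases q with
    | nil => simp at hp
    | @cons _ d _ hxd q =>
      rw [Walk.cons_isPath_iff] at hp hq
      have hmem : s(x, c) ∈ (Walk.cons hxd q).edges := (h _).1 (by simp)
      rw [Walk.edges_cons, List.mem_cons] at hmem
      obtain rfl : c = d := by
        rcases hmem with h' | h'
        · exact Sym2.congr_right.1 h'
        · exact absurd (Walk.fst_mem_support_of_mem_edges q h') hq.2
      rw [ih hp.1 hq.1 fun e => ?_]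
      have he := h e
      rw [Walk.edges_cons, Walk.edges_cons, List.mem_cons, List.mem_cons] at he
      by_cases hex : e = s(x, c)
      · subst hex
        exact ⟨fun h' => absurd (Walk.fst_mem_support_of_mem_edges p h') hp.2,
          fun h' => absurd (Walk.fst_mem_support_of_mem_edges q h') hq.2⟩
      · simpa [hex] using he

theorem Walk.IsPath.length_eq_one {W : Type*} {H : SimpleGraph W} {x y : W} {p : H.Walk x y}
    (hp : p.IsPath) (h : s(x, y) ∈ p.edges) : p.length = 1 := by
  cases p with
  | nil => simp at h
  | @cons _ c _ hxc q =>
    rw [Walk.cons_isPath_iff] at hp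
    rw [Walk.edges_cons, List.mem_cons] at h
    rcases h with h' | h'
    · obtain rfl : y = c := Sym2.congr_right.1 h'
      rw [Walk.eq_nil_iff_nil.2 (Walk.isPath_iff_nil.1 hp.1)]
      rfl
    · exact absurd (Walk.fst_mem_support_of_mem_edges q h') hp.2

theorem Walk.IsPath.mem_hamiltonianCycles {W : Type*} {H : SimpleGraph W} {x y : W}
    {p : H.Walk x y} (hp : p.IsPath) (hall : ∀ z, z ∈ p.support) (h : H.Adj y x)
    (he : s(y, x) ∉ p.edges) : {e | e ∈ (Walk.cons h p).edges} ∈ H.hamiltonianCycles := by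
  classical
  refine ⟨y, Walk.cons h p, ?_, rfl⟩
  rw [Walk.isHamiltonianCycle_iff_isCycle_and_support_count_tail_eq_one]
  refine ⟨(Walk.cons_isCycle_iff _ _).2 ⟨hp, he⟩, fun z => ?_⟩
  rw [Walk.support_cons, List.tail_cons]
  exact List.count_eq_one_of_mem hp.support_nodup (hall z)

end SimpleGraph

namespace Matroid

open SetFamily

theorem isBasisFamily_bases {β : Type*} (M : Matroid β) : IsBasisFamily {B | M.IsBase B} where
  exchange := fun U hU V hV a ha => IsBase.exchange hU hV ha
  rev_exchange := by
    intro U hU V hV b hb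
    have hU' : M.IsBase U := hU
    have hV' : M.IsBase V := hV
    have hbE : b ∈ M.E := hV'.subset_ground hb.1
    -- The reverse exchange is ordinary exchange between the complements in the dual matroid.
    obtain ⟨a, ha, h⟩ := hU'.compl_isBase_dual.exchange hV'.compl_isBase_dual
      (e := b) ⟨⟨hbE, hb.2⟩, fun h => h.2 hb.1⟩
    have haU : a ∈ U := by
      by_contra haU
      exact ha.2 ⟨ha.1.1, haU⟩
    refine ⟨a, ⟨haU, ha.1.2⟩, ?_⟩
    have h' := h.compl_isBase_of_dual
    have : M.E \ insert a ((M.E \ U) \ {b}) = insert b (U \ {a}) := by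
      ext z
      have hz : z ∈ U → z ∈ M.E := fun h => hU'.subset_ground h
      have hbU := hb.2
      simp only [Set.mem_sdiff, Set.mem_insert_iff, Set.mem_singleton_iff]
      grind
    rwa [this] at h'

theorem basisGraph_adj_iff {β : Type*} {M : Matroid β} {A B : {B : Set β // M.IsBase B}} :
    M.basisGraph.Adj A B ↔ Exch (A : Set β) (B : Set β) := by
  change ((A : Set β) ∆ (B : Set β)).encard = 2 ↔ _
  constructor
  · intro h
    have hne : (A : Set β) ≠ B := by
      intro hAB
      rw [hAB] at h
      simp at h
    have key : ∀ {U V : Set β}, M.IsBase U → M.IsBase V → U ≠ V → ∃ a, a ∈ U ∧ a ∉ V := by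
      intro U V hU hV hUV
      by_contra! hcon
      exact hUV (M.isBasisFamily_bases.eq_of_subset hU hV hcon)
    obtain ⟨a, haA, haB⟩ := key A.2 B.2 hne
    obtain ⟨b, hbB, hbA⟩ := key B.2 A.2 hne.symm
    have hab : a ≠ b := fun h => hbA (h ▸ haA)
    have hsub : ({a, b} : Set β) ⊆ (A : Set β) ∆ (B : Set β) := by
      rintro z (rfl | rfl)
      exacts [Or.inl ⟨haA, haB⟩, Or.inr ⟨hbB, hbA⟩]
    have heq := Set.Finite.eq_of_subset_of_encard_le'
      (Set.finite_of_encard_le_coe (k := 2) h.le) hsub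
      (by rw [h, Set.encard_pair hab])
    refine ⟨a, haA, b, hbA, ?_⟩
    ext z
    have hz := Set.ext_iff.1 heq z
    simp only [Set.mem_symmDiff, Set.mem_insert_iff, Set.mem_singleton_iff] at hz
    simp only [Set.mem_insert_iff, Set.mem_sdiff, Set.mem_singleton_iff]
    grind
  · rintro ⟨a, ha, b, hb, hB⟩
    rw [hB]
    have hab : a ≠ b := fun h => hb (h ▸ ha)
    rw [← Set.encard_pair hab]
    congr 1
    ext z
    simp only [Set.mem_symmDiff, Set.mem_insert_iff, Set.mem_sdiff, Set.mem_singleton_iff]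
    grind

theorem exists_walk_of_chain {β : Type*} {M : Matroid β} (l : List (Set β))
    {A B : {B : Set β // M.IsBase B}} (hl : ∀ X ∈ l, M.IsBase X) (hc : l.IsChain Exch)
    (hA : l.head? = some A.1) (hB : l.getLast? = some B.1) :
    ∃ p : M.basisGraph.Walk A B, p.support.map Subtype.val = l := by
  induction l generalizing A with
  | nil => simp at hA
  | cons X t ih =>
    obtain rfl : X = A.1 := by simpa using hA
    rcases t with _ | ⟨Y, t⟩
    · obtain rfl : A = B := Subtype.ext (by simpa using hB)
      exact ⟨SimpleGraph.Walk.nil, rfl⟩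
    · rw [List.isChain_cons_cons] at hc
      obtain ⟨p, hp⟩ := ih (A := ⟨Y, hl Y (by simp)⟩) (fun Z hZ => hl Z (List.mem_cons_of_mem _ hZ))
        hc.2 rfl (by rw [← hB, List.getLast?_cons_cons])
      refine ⟨SimpleGraph.Walk.cons (basisGraph_adj_iff.2 hc.1) p, ?_⟩
      rw [SimpleGraph.Walk.support_cons, List.map_cons, hp]

theorem ncard_hamPaths_le {β : Type*} {M : Matroid β} (hM : {B | M.IsBase B}.Finite)
    (h3 : 3 ≤ {B | M.IsBase B}.ncard) {A B : {B : Set β // M.IsBase B}}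
    (hAB : M.basisGraph.Adj A B) :
    (hamPaths {B | M.IsBase B} A.1 B.1).ncard ≤
      M.basisGraph.numHamiltonianCycles s(A, B) := by
  classical
  have : Finite {B : Set β // M.IsBase B} := hM.to_subtype
  have hex : ∀ l ∈ hamPaths {B | M.IsBase B} A.1 B.1, ∃ p : M.basisGraph.Walk A B,
      p.support.map Subtype.val = l := fun l hl =>
    exists_walk_of_chain l (fun X hX => (IsHamPath.mem_iff hl X).1 hX) (IsHamPath.chain hl)
      (IsHamPath.head hl) (IsHamPath.last hl)
  have : Nonempty (M.basisGraph.Walk A B) := ⟨hAB.toWalk⟩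
  choose! p hp using hex
  have hpath : ∀ l ∈ hamPaths {B | M.IsBase B} A.1 B.1, (p l).IsPath := by
    intro l hl
    refine SimpleGraph.Walk.IsPath.mk' (List.Nodup.of_map Subtype.val ?_)
    rw [hp l hl]
    exact IsHamPath.nodup hl
  -- A path using the closing edge would consist of it alone, leaving only two bases.
  have hedge : ∀ l ∈ hamPaths {B | M.IsBase B} A.1 B.1, s(B, A) ∉ (p l).edges := by
    intro l hl he
    have h1 := (hpath l hl).length_eq_one (Sym2.eq_swap ▸ he)
    have h2 := congrArg List.length (hp l hl)
    rw [List.length_map, SimpleGraph.Walk.length_support, IsHamPath.length_eq hl] at h2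
    omega
  refine Set.ncard_le_ncard_of_injOn
    (fun l => {e | e ∈ (SimpleGraph.Walk.cons hAB.symm (p l)).edges}) ?_ ?_ (Set.toFinite _)
  · intro l hl
    refine ⟨(hpath l hl).mem_hamiltonianCycles (fun X => ?_) hAB.symm (hedge l hl), ?_⟩
    · have hX : X.1 ∈ l := (IsHamPath.mem_iff hl _).2 X.2
      rw [← hp l hl, List.mem_map] at hX
      obtain ⟨Y, hY, hYX⟩ := hX
      exact Subtype.ext hYX ▸ hY
    · rw [Sym2.eq_swap]
      simp
  · intro l hl l' hl' heq
    have : p l = p l' := by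
      refine (hpath l hl).eq_of_edges (hpath l' hl') fun e => ?_
      have he := Set.ext_iff.1 heq e
      simp only [Set.mem_ofPred_eq, SimpleGraph.Walk.edges_cons, List.mem_cons] at he
      by_cases heAB : e = s(B, A)
      · subst heAB
        simp [hedge l hl, hedge l' hl']
      · simpa [heAB] using he
    rw [← hp l hl, ← hp l' hl', this]

end Matroid

/-! ### Cycle matroids of 3-edge-connected graphs. -/

namespace Graph

open SetFamily

/-- Modulo 2 the incidence vectors telescope along a walk. -/
theorem single_add_single_mem {α β : Type*} {G : Graph α β} {F : Set β}
    {S : Submodule (ZMod 2) (α →₀ ZMod 2)} (hS : ∀ f ∈ E(G), f ∉ F → G.incVec f ∈ S) {x y : α}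
    (h : Relation.ReflTransGen (G.deleteEdges F).Adj x y) :
    Finsupp.single x 1 + Finsupp.single y 1 ∈ S := by
  induction h with
  | refl =>
    rw [← Finsupp.single_add, CharTwo.add_self_eq_zero, Finsupp.single_zero]
    exact S.zero_mem
  | @tail b c _ hbc ih =>
    obtain ⟨f, hf⟩ := hbc
    rw [deleteEdges_isLink] at hf
    have h1 := hS f hf.1.edge_mem hf.2
    rw [G.incVec_eq hf.1] at h1
    have h2 := S.add_mem ih h1
    have h3 : (Finsupp.single b 1 : α →₀ ZMod 2) + Finsupp.single b 1 = 0 := by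
      rw [← Finsupp.single_add, CharTwo.add_self_eq_zero, Finsupp.single_zero]
    have h4 : (Finsupp.single x 1 + Finsupp.single b 1 : α →₀ ZMod 2) +
        (Finsupp.single b 1 + Finsupp.single c 1) =
        Finsupp.single x 1 + (Finsupp.single b 1 + Finsupp.single b 1) + Finsupp.single c 1 := by
      abel
    rwa [h4, h3, add_zero] at h2

theorem cycleMatroid_indep_iff {α β : Type*} {G : Graph α β} {F : Set β} :
    G.cycleMatroid.Indep F ↔ F ⊆ E(G) ∧ LinearIndepOn (ZMod 2) G.incVec F :=
  isForest_iff G F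

/-- A maximal independent set of remaining edges spans every deleted edge too, through a walk
between its ends. -/
theorem exists_isBase_disjoint {α β : Type*} {G : Graph α β} {F : Set β}
    (h : (G.deleteEdges F).Connected) : ∃ B, G.cycleMatroid.IsBase B ∧ Disjoint B F := by
  obtain ⟨B, hBsub, -, hspan, hli⟩ := exists_linearIndepOn_extension (v := G.incVec)
    (linearIndepOn_empty (ZMod 2) G.incVec) (Set.empty_subset (E(G) \ F))
  refine ⟨B, ?_, Set.disjoint_left.2 fun e he => (hBsub he).2⟩
  rw [Matroid.isBase_iff_maximal_indep]
  refine ⟨cycleMatroid_indep_iff.2 ⟨fun e he => (hBsub he).1, hli⟩, fun J hJ hBJ e he => ?_⟩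
  by_contra heB
  rw [cycleMatroid_indep_iff] at hJ
  refine linearIndepOn_iff_notMem_span.1 hJ.2 e he ?_
  have hmono : Submodule.span (ZMod 2) (G.incVec '' B) ≤
      Submodule.span (ZMod 2) (G.incVec '' (J \ {e})) :=
    Submodule.span_mono (Set.image_mono fun f hf => ⟨hBJ hf, fun h => heB (h ▸ hf)⟩)
  refine hmono ?_
  obtain ⟨x, y, hxy⟩ := G.exists_isLink_of_mem_edgeSet (hJ.1 he)
  rw [G.incVec_eq hxy]
  exact single_add_single_mem (fun f hf hfF => hspan ⟨f, ⟨hf, hfF⟩, rfl⟩)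
    (h.2 x hxy.left_mem y hxy.right_mem)

theorem incVec_mem_span_of_isBase {α β : Type*} {G : Graph α β} {B : Set β}
    (hB : G.cycleMatroid.IsBase B) {e : β} (he : e ∈ E(G)) :
    G.incVec e ∈ Submodule.span (ZMod 2) (G.incVec '' B) := by
  by_contra hns
  have hBi := cycleMatroid_indep_iff.1 hB.indep
  have h : G.cycleMatroid.Indep (insert e B) :=
    cycleMatroid_indep_iff.2 ⟨Set.insert_subset he hBi.1, hBi.2.insert hns⟩
  have heB : e ∈ B := (Matroid.isBase_iff_maximal_indep.1 hB).2 h (Set.subset_insert _ _)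
    (Set.mem_insert _ _)
  exact hns (Submodule.subset_span ⟨e, heB, rfl⟩)

/-- The vectors of `B` together with one vertex vector span all vertex vectors, by telescoping from
that vertex. -/
theorem ncard_vertexSet_le_of_isBase {α β : Type*} {G : Graph α β} (hV : V(G).Finite)
    (hE : E(G).Finite) (h : G.Connected) {B : Set β} (hB : G.cycleMatroid.IsBase B) :
    V(G).ncard ≤ B.ncard + 1 := by
  classical
  obtain ⟨x, hx⟩ := h.1
  have hBfin : B.Finite := hE.subset hB.subset_ground
  have : Fintype V(G) := hV.fintype
  set T : Set (α →₀ ZMod 2) := insert (Finsupp.single x 1) (G.incVec '' B) with hT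
  have hTfin : T.Finite := (hBfin.image _).insert _
  have : Fintype T := hTfin.fintype
  have hli : LinearIndependent (ZMod 2) fun v : V(G) => (Finsupp.single v.1 1 : α →₀ ZMod 2) :=
    (Finsupp.linearIndependent_single_one (ZMod 2) α).comp _ Subtype.val_injective
  have hle : Submodule.span (ZMod 2)
      (Set.range fun v : V(G) => (Finsupp.single v.1 1 : α →₀ ZMod 2)) ≤
      Submodule.span (ZMod 2) T := by
    rw [Submodule.span_le]
    rintro _ ⟨y, rfl⟩
    have h1 := single_add_single_mem (G := G) (F := ∅) (S := Submodule.span (ZMod 2) T)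
      (fun f hf _ => Submodule.span_mono (Set.subset_insert _ _) (incVec_mem_span_of_isBase hB hf))
      (x := x) (y := y.1) (by rw [deleteEdges_empty]; exact h.2 x hx y y.2)
    exact (Submodule.add_mem_iff_right _ (Submodule.subset_span (Set.mem_insert _ _))).1 h1
  have : Module.Finite (ZMod 2) (Submodule.span (ZMod 2) T) :=
    FiniteDimensional.span_of_finite _ hTfin
  have h1 := Submodule.finrank_mono hle
  rw [finrank_span_eq_card hli] at h1
  have h2 := finrank_span_le_card (R := ZMod 2) T
  rw [← Set.ncard_eq_toFinset_card'] at h2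
  have h3 : T.ncard ≤ B.ncard + 1 :=
    (Set.ncard_insert_le _ _).trans (Nat.add_le_add_right (Set.ncard_image_le hBfin) 1)
  rw [← Nat.card_coe_set_eq, Nat.card_eq_fintype_card]
  omega

/-- The edge `e` has exactly one end in `U`. -/
def Crosses {α β : Type*} (G : Graph α β) (U : Set α) (e : β) : Prop :=
  ∃ p ∈ U, ∃ q ∉ U, G.IsLink e p q

theorem IsLink.crosses_iff {α β : Type*} {G : Graph α β} {U : Set α} {e : β} {p q : α}
    (h : G.IsLink e p q) : G.Crosses U e ↔ ¬ (p ∈ U ↔ q ∈ U) := by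
  constructor
  · rintro ⟨p', hp', q', hq', h'⟩
    rcases h.isLink_iff.1 h' with ⟨rfl, rfl⟩ | ⟨rfl, rfl⟩ <;> tauto
  · intro hpq
    by_cases hp : p ∈ U
    · exact ⟨p, hp, q, by tauto, h⟩
    · exact ⟨q, by tauto, p, hp, h.symm⟩

theorem IsLink.crosses_symmDiff_iff {α β : Type*} {G : Graph α β} {U W : Set α} {e : β} {p q : α}
    (h : G.IsLink e p q) :
    G.Crosses (U ∆ W) e ↔ ¬ (G.Crosses U e ↔ G.Crosses W e) := by
  rw [h.crosses_iff, h.crosses_iff, h.crosses_iff, Set.mem_symmDiff, Set.mem_symmDiff]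
  tauto

theorem Crosses.exists_isLink {α β : Type*} {G : Graph α β} {U : Set α} {e : β}
    (h : G.Crosses U e) : ∃ p q, G.IsLink e p q := by
  obtain ⟨p, -, q, -, h⟩ := h
  exact ⟨p, q, h⟩

theorem exists_cut {α β : Type*} {G : Graph α β} {F : Set β} (hV : V(G).Nonempty)
    (h : ¬ (G.deleteEdges F).Connected) : ∃ U : Set α, (∃ x ∈ V(G), x ∈ U) ∧
      (∃ y ∈ V(G), y ∉ U) ∧ ∀ e, G.Crosses U e → e ∈ F := by
  have : ∃ x ∈ V(G), ∃ y ∈ V(G), ¬ Relation.ReflTransGen (G.deleteEdges F).Adj x y := by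
    by_contra! hcon
    exact h ⟨hV, hcon⟩
  obtain ⟨x, hx, y, hy, hxy⟩ := this
  refine ⟨{z | Relation.ReflTransGen (G.deleteEdges F).Adj x z},
    ⟨x, hx, Relation.ReflTransGen.refl⟩, ⟨y, hy, hxy⟩, ?_⟩
  rintro e ⟨p, hp, q, hq, hl⟩
  by_contra he
  exact hq (Relation.ReflTransGen.tail hp ⟨e, by rw [deleteEdges_isLink]; exact ⟨hl, he⟩⟩)

theorem IsEdgeConnected.exists_crosses {α β : Type*} {G : Graph α β} {k : ℕ}
    (h : G.IsEdgeConnected k) {K : Set β} (hK : K.encard < k) {U : Set α}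
    (hx : ∃ x ∈ V(G), x ∈ U) (hy : ∃ y ∈ V(G), y ∉ U) : ∃ e ∉ K, G.Crosses U e := by
  obtain ⟨x, hxV, hxU⟩ := hx
  obtain ⟨y, hyV, hyU⟩ := hy
  have hcon := (h (K ∩ E(G)) Set.inter_subset_right
    ((Set.encard_le_encard Set.inter_subset_left).trans_lt hK)).2 x hxV y hyV
  by_contra! hno
  refine hyU ?_
  clear hyV hyU
  induction hcon with
  | refl => exact hxU
  | @tail p q _ hpq ih =>
    by_contra hq
    obtain ⟨f, hf⟩ := hpq
    rw [deleteEdges_isLink] at hf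
    exact hno f (fun hfK => hf.2 ⟨hfK, hf.1.edge_mem⟩) ⟨p, ih, q, hq, hf.1⟩

theorem IsEdgeConnected.connected {α β : Type*} {G : Graph α β} (h : G.IsEdgeConnected 3) :
    G.Connected := by
  have := h ∅ (Set.empty_subset _) (by simp)
  rwa [deleteEdges_empty] at this

theorem encard_pair_lt_three {β : Type*} (a b : β) : ({a, b} : Set β).encard < (3 : ℕ) := by
  refine (Set.encard_insert_le {b} a).trans_lt ?_
  rw [Set.encard_singleton]
  norm_num

/-- Two distinct three-element bonds of a 3-edge-connected graph share at most one edge. -/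
theorem IsEdgeConnected.connected_delete_triple {α β : Type*} {G : Graph α β}
    (h : G.IsEdgeConnected 3) {g a b c : β} (hgb : g ≠ b) (hab : a ≠ b)
    (hbc : b ≠ c) :
    (G.deleteEdges {g, a, b}).Connected ∨ (G.deleteEdges {g, a, c}).Connected := by
  by_contra! hcon
  obtain ⟨U, hU, hU', hUc⟩ := exists_cut h.connected.1 hcon.1
  obtain ⟨W, hW, hW', hWc⟩ := exists_cut h.connected.1 hcon.2
  -- A cut contained in a triple uses all of it, since no two edges separate the graph.
  have key : ∀ {U : Set α} {x y z : β}, (∃ x ∈ V(G), x ∈ U) → (∃ y ∈ V(G), y ∉ U) →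
      (∀ e, G.Crosses U e → e = x ∨ e = y ∨ e = z) → G.Crosses U x := by
    intro U x y z hU hU' hc
    obtain ⟨e, he, hce⟩ := h.exists_crosses (encard_pair_lt_three y z) hU hU'
    rw [Set.mem_insert_iff, Set.mem_singleton_iff, not_or] at he
    rcases hc e hce with rfl | rfl | rfl
    exacts [hce, absurd rfl he.1, absurd rfl he.2]
  simp only [Set.mem_insert_iff, Set.mem_singleton_iff] at hUc hWc
  have hUg : G.Crosses U g := key hU hU' hUc
  have hUa : G.Crosses U a := key (y := g) (z := b) hU hU' fun e he => or_left_comm.1 (hUc e he)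
  have hUb : G.Crosses U b := key (y := g) (z := a) hU hU' fun e he => or_rotate.2 (hUc e he)
  have hWg : G.Crosses W g := key hW hW' hWc
  have hWa : G.Crosses W a := key (y := g) (z := c) hW hW' fun e he => or_left_comm.1 (hWc e he)
  have hWb : ¬ G.Crosses W b := fun h' => by
    rcases hWc b h' with h1 | h1 | h1
    exacts [hgb h1.symm, hab h1.symm, hbc h1]
  -- The edge `b` crosses `U` but not `W`, so `U ∆ W` separates vertices. As `g` and `a` cross both,
  -- only `b` and `c` can cross `U ∆ W`, contradicting 3-edge-connectivity.
  obtain ⟨p, q, hl⟩ := hUb.exists_isLink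
  obtain ⟨p', hp', q', hq', hl'⟩ := (hl.crosses_symmDiff_iff (U := U) (W := W)).2
    fun h' => hWb (h'.1 hUb)
  obtain ⟨e, he, hce⟩ := h.exists_crosses (encard_pair_lt_three b c) ⟨p', hl'.left_mem, hp'⟩
    ⟨q', hl'.right_mem, hq'⟩
  rw [Set.mem_insert_iff, Set.mem_singleton_iff, not_or] at he
  obtain ⟨p, q, hl⟩ := hce.exists_isLink
  have hne := hl.crosses_symmDiff_iff.1 hce
  have hg : e ≠ g := fun h' => hne (h' ▸ iff_of_true hUg hWg)
  have ha : e ≠ a := fun h' => hne (h' ▸ iff_of_true hUa hWa)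
  have h1 : ¬ G.Crosses U e := fun h' => by
    rcases hUc e h' with h2 | h2 | h2
    exacts [hg h2, ha h2, he.1 h2]
  have h1' : ¬ G.Crosses W e := fun h' => by
    rcases hWc e h' with h2 | h2 | h2
    exacts [hg h2, ha h2, he.2 h2]
  exact hne (iff_of_false h1 h1')

theorem IsEdgeConnected.isThick {α β : Type*} {G : Graph α β} (hE : E(G).Finite)
    (h : G.IsEdgeConnected 3) : IsThick {B | G.cycleMatroid.IsBase B} ∅ where
  isBasisFamily := G.cycleMatroid.isBasisFamily_bases
  finite := hE.finite_subsets.subset fun B hB =>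
    Matroid.IsBase.subset_ground (M := G.cycleMatroid) (B := B) hB
  subset := fun _ _ => Set.empty_subset _
  avoid_pair := by
    intro a _ b _
    obtain ⟨B, hB, hd⟩ := exists_isBase_disjoint (h ({a, b} ∩ E(G)) Set.inter_subset_right
      ((Set.encard_le_encard Set.inter_subset_left).trans_lt (encard_pair_lt_three a b)))
    refine ⟨B, hB, Set.disjoint_left.2 fun e he heab => ?_⟩
    exact Set.disjoint_left.1 hd he ⟨heab, hB.subset_ground he⟩
  avoid_triple := by
    intro g _ a _ b _ c _ _ hgb _ hab _ hbc
    exact (h.connected_delete_triple hgb hab hbc).imp exists_isBase_disjoint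
      exists_isBase_disjoint

theorem IsEdgeConnected.le_ncard_of_isBase {α β : Type*} {G : Graph α β} {n : ℕ}
    (hV : V(G).encard = n) (hE : E(G).Finite) (h : G.IsEdgeConnected 3) {B : Set β}
    (hB : G.cycleMatroid.IsBase B) : n - 1 ≤ (B \ ∅).ncard := by
  have h1 := ncard_vertexSet_le_of_isBase (Set.finite_of_encard_eq_coe hV) hE h.connected hB
  rw [Set.ncard_def, hV, ENat.toNat_natCast] at h1
  rw [Set.sdiff_empty]
  omega

theorem IsEdgeConnected.le_numHamiltonianCycles {α β : Type*} {G : Graph α β} {n : ℕ} (hn : 3 ≤ n)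
    (hV : V(G).encard = n) (hE : E(G).Finite) (h : G.IsEdgeConnected 3)
    {e : Sym2 {B : Set β // G.cycleMatroid.IsBase B}}
    (he : e ∈ G.cycleMatroid.basisGraph.edgeSet) :
    (n - 2).factorial * 2 ^ (n - 1).choose 2 ≤ G.cycleMatroid.basisGraph.numHamiltonianCycles e := by
  induction e using Sym2.ind with
  | _ A B =>
  rw [SimpleGraph.mem_edgeSet] at he
  have ht := h.isThick hE
  have hA := h.le_ncard_of_isBase hV hE A.2
  have h3 := ht.isBasisFamily.lt_ncard ht.finite ht.avoid (A := A.1) A.2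
  refine le_trans ?_ (Matroid.ncard_hamPaths_le ht.finite (by omega) he)
  exact ht.le_ncard_hamPaths (n - 1) (fun B hB => h.le_ncard_of_isBase hV hE hB) A.2 B.2
    (Matroid.basisGraph_adj_iff.1 he)

/-- Needed because `minHamiltonianCycles` would be `sInf ∅ = 0` for a basis graph without edges. -/
theorem IsEdgeConnected.nonempty_edgeSet_basisGraph {α β : Type*} {G : Graph α β} {n : ℕ}
    (hn : 3 ≤ n) (hV : V(G).encard = n) (hE : E(G).Finite) (h : G.IsEdgeConnected 3) :
    G.cycleMatroid.basisGraph.edgeSet.Nonempty := by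
  have ht := h.isThick hE
  obtain ⟨A, hA⟩ := G.cycleMatroid.exists_isBase
  have hr := h.le_ncard_of_isBase hV hE hA
  obtain ⟨a, ha⟩ := Set.nonempty_of_ncard_ne_zero (s := A \ ∅) (by omega)
  obtain ⟨C, hC, haC⟩ := ht.avoid a ha.2
  obtain ⟨x, hx, -, hB⟩ := ht.isBasisFamily.exists_insert hA hC ha.1 haC
  exact ⟨s(⟨A, hA⟩, ⟨_, hB⟩), Matroid.basisGraph_adj_iff.2 ⟨a, ha.1, x, hx, rfl⟩⟩

/-- The graph on `Fin (n + 1)` with three edges from `0` to every vertex (three of them loops). -/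
def tripleStar (n : ℕ) : Graph (Fin (n + 1)) (Fin (n + 1) × Fin 3) where
  vertexSet := Set.univ
  IsLink e x y := (x = 0 ∧ y = e.1) ∨ (y = 0 ∧ x = e.1)
  isLink_symm := fun _ _ => ⟨fun _ _ h => h.symm⟩
  eq_or_eq_of_isLink_of_isLink := by grind
  left_mem_of_isLink := fun _ _ _ _ => Set.mem_univ _

/-- Fewer than three deletions leave an edge from `0` to every vertex. -/
theorem isEdgeConnected_tripleStar (n : ℕ) : (tripleStar n).IsEdgeConnected 3 := by
  intro F _ hF
  have hadj : ∀ x, ((tripleStar n).deleteEdges F).Adj 0 x := by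
    intro x
    by_contra hno
    have hsub : Set.range (fun j : Fin 3 => (x, j)) ⊆ F := by
      rintro _ ⟨j, rfl⟩
      by_contra hj
      exact hno ⟨(x, j), by rw [deleteEdges_isLink]; exact ⟨Or.inl ⟨rfl, rfl⟩, hj⟩⟩
    have h1 := Set.encard_le_encard hsub
    rw [← Set.image_univ, Function.Injective.encard_image (fun i j hij => congrArg Prod.snd hij),
      Set.encard_univ, ENat.card_eq_coe_fintype_card, Fintype.card_fin] at h1
    exact (h1.trans_lt hF).ne rfl
  refine ⟨⟨0, Set.mem_univ _⟩, fun x _ y _ => ?_⟩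
  exact (Relation.ReflTransGen.single (hadj x).symm).tail (hadj y)

end Graph

theorem mainTheorem2 (n : ℕ) (hn : 3 ≤ n) :
    (∀ {α β : Type*} (G : Graph α β), V(G).encard = n → E(G).Finite → G.IsEdgeConnected 3 →
      ∀ e ∈ G.cycleMatroid.basisGraph.edgeSet,
        (n - 2).factorial * 2 ^ (n - 1).choose 2 ≤
          G.cycleMatroid.basisGraph.numHamiltonianCycles e) ∧
    (n - 2).factorial * 2 ^ (n - 1).choose 2 ≤ Graph.hc n 3 := by
  refine ⟨fun G hV hE hG e he => hG.le_numHamiltonianCycles hn hV hE he, le_csInf ?_ ?_⟩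
  -- The infimum defining `hc` must be over a nonempty set, its default value being `0`; the triple
  -- star on `n` vertices is a witness.
  · refine ⟨_, _, _, Graph.tripleStar (n - 1), ?_, Set.toFinite _,
      Graph.isEdgeConnected_tripleStar _, rfl⟩
    have h : V(Graph.tripleStar (n - 1)) = Set.univ := rfl
    rw [h, Set.encard_univ, ENat.card_eq_coe_fintype_card, Fintype.card_fin,
      Nat.sub_add_cancel (by omega)]
  · rintro _ ⟨α, β, G, hV, hE, hG, rfl⟩
    obtain ⟨e, he⟩ := hG.nonempty_edgeSet_basisGraph hn hV hE
    refine le_csInf ⟨_, e, he, rfl⟩ ?_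
    rintro _ ⟨e, he, rfl⟩
    exact hG.le_numHamiltonianCycles hn hV hE he
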